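/- Equip $\mathbb{C}^n$ with the standard symplectic form $\sum_i dx_i\wedge dy_i$, $z_i=x_i+iy_i$. Let $a>1$, $S>0$, let $\frac{a}{a+1}\le\mu\le\frac a2$, and put $\lambda=1-\frac{\mu}{a}$. Let $$E(a,1,S)=\Big\{(z_1,z_2,z_3)\in\mathbb{C}^3 : \frac{\pi|z_1|^2}{a}+\pi|z_2|^2+\frac{\pi|z_3|^2}{S}\le 1\Big\}$$ be the closed ellipsoid, and for $t\le\lambda+\mu$ let $$f(t)=\begin{cases}2\lambda-\dfrac t2 & \text{if } t\le 2\mu\,\dfrac{2\lambda-1}{\lambda+\mu-1},\\[2mm] 1-\dfrac{(1-\lambda)(t-2\lambda+1)}{1-\lambda+\mu} & \text{if } 2\mu\,\dfrac{2\lambda-1}{\lambda+\mu-1}\le t\le\lambda+\mu.\end{cases}$$ Then for every neighborhood $U$ in $\mathbb{C}^3$ of the set $$\{(z_1,z_2)\in\mathbb{C}^2 : \pi|z_1|^2\le\lambda+\mu,\ \pi|z_2|^2\le f(\pi|z_1|^2)\}\times\mathbb{C}$$ there is a symplectic embedding of $E(a,1,S)$ into $U$; that is, there is a smooth, injective map,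 defined on an open neighborhood of $E(a,1,S)$ in $\mathbb{C}^3$ and preserving the symplectic form there, which maps $E(a,1,S)$ into $U$. -/

import Mathlib

open scoped Topology ContDiff

noncomputable section

/-- The standard symplectic form `∑ dxᵢ ∧ dyᵢ` on `ℂⁿ`, with `zᵢ = xᵢ + i yᵢ`; indeed
`Im (conj v * w) = Re v * Im w - Im v * Re w`. -/
def stdSymplectic {n : ℕ} (v w : Fin n → ℂ) : ℝ :=
  ∑ i, ((v i).re * (w i).im - (v i).im * (w i).re)

/-- `φ` is a symplectic embedding of the subset `A` of `ℂⁿ` into `ℂⁿ`. As usual for sets that are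
not open, this means that `φ` is a smooth symplectic embedding of some open neighborhood `V` of `A`.
Since `D φ` preserves the nondegenerate form, it is invertible on `V`, so that an injective such `φ`
is a diffeomorphism from `V` onto an open set. -/
def IsSymplecticEmbeddingOn {n : ℕ} (φ : (Fin n → ℂ) → (Fin n → ℂ)) (A : Set (Fin n → ℂ)) : Prop :=
  ∃ V : Set (Fin n → ℂ), IsOpen V ∧ A ⊆ V ∧
    ContDiffOn ℝ ∞ φ V ∧ Set.InjOn φ V ∧
    ∀ z ∈ V, ∀ v w : Fin n → ℂ,
      stdSymplectic (fderiv ℝ φ z v) (fderiv ℝ φ z w) = stdSymplectic v w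

/-- `A` embeds symplectically into `U`. -/
def SymplecticallyEmbeds {n : ℕ} (A U : Set (Fin n → ℂ)) : Prop :=
  ∃ φ : (Fin n → ℂ) → (Fin n → ℂ), IsSymplecticEmbeddingOn φ A ∧ Set.MapsTo φ A U

/-- The closed ellipsoid `E(c₁, …, cₙ) = {∑ π |zᵢ|² / cᵢ ≤ 1}` in `ℂⁿ`. -/
def ellipsoid {n : ℕ} (c : Fin n → ℝ) : Set (Fin n → ℂ) :=
  {z | ∑ i, Real.pi * ‖z i‖ ^ 2 / c i ≤ 1}

/-- The piecewise linear function bounding `π |z₂|²` in terms of `t = π |z₁|²`. -/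
def foldBound (lam μ t : ℝ) : ℝ :=
  if t ≤ 2 * μ * ((2 * lam - 1) / (lam + μ - 1)) then
    2 * lam - t / 2
  else
    1 - (1 - lam) * (t - 2 * lam + 1) / (1 - lam + μ)

/-- The domain `{π |z₁|² ≤ λ + μ, π |z₂|² ≤ f(π |z₁|²)}` in `ℂ²`. -/
def foldDomain (lam μ : ℝ) : Set (ℂ × ℂ) :=
  {z | Real.pi * ‖z.1‖ ^ 2 ≤ lam + μ ∧
    Real.pi * ‖z.2‖ ^ 2 ≤ foldBound lam μ (Real.pi * ‖z.1‖ ^ 2)}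

/-- The product `X × ℂ` in `ℂ³`, for a subset `X` of `ℂ²`. -/
def stabilize (X : Set (ℂ × ℂ)) : Set (Fin 3 → ℂ) :=
  {z | (z 0, z 1) ∈ X}

end

/-!
The embedding is a multiple symplectic fold in which overlapping sheets are separated in the last
factor. All maps are explicit compositions of area-preserving planar maps and of two Hamiltonian
shears.

*Straightening.* Passing from `ℂ` to the hyperbolic half-plane by an area-preserving map that
respects rotations gives an explicit area-preserving embedding `toStrip` of `ℂ` into the half-strip
`(0, ∞) × (0, 1)` which takes the disc of area `t` into `(0, t + ε) × (0, 1)`. Applied to the first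
two factors it turns the ellipsoid into the set `X / a + w < 1 + ε`, with coordinates `X, Y` for the
base, an area coordinate `w` and an angle for the fibre.

*The ribbon.* The part `X ≤ μ` of the base is only reshaped. Beyond it the base is narrowed to a
ribbon of small width `η`, over which the fibres have area at most `lam`; it is turned by a right
angle, and its position `x` along its length becomes the angle of the final base plane, so that the
ribbon winds around the plane many times (`FoldData.ribbon`, `FoldData.wrap`).

*The lift.* While `x` increases by `1`, the fibre is moved off itself, from the disc of area `lam`
to the annulus between the areas `lam` and `2 lam`, or back. The Hamiltonian is `-x w` up to a
function of `x`, so the ribbon is swept over the coordinates `u` between `0` and `lam - w`. Hence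
`u + w' ≤ 2 lam` for the final fibre area `w'` (`FoldData.level_bounds`). The final area coordinate
of the base is `t = max (2 u) ((a + 1) u - a (2 lam - 1))`, smoothed, and this turns
`u + w' ≤ 2 lam` into the bound `foldBound` (`le_foldBound`). Its slope is at least `2` and exceeds
by at least `1` the slope of the profile of the base before the cut; so there is room on each circle
for two consecutive turns, and for the first turn next to the part of the base before the cut.

*Separation.* The flow of `κ(w') y₂` translates the last factor by `κ(w')` and only rotates the
second factor, so it costs no area. With `κ` constant on the disc of area `lam` and on the annulus,
and increasing at each stage, the sheets of stages which differ by at least two become disjoint,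
however large `S` is (`FoldData.injOn_fold`).

*Noncompactness of the target.* A neighborhood of `X × ℂ` may become thin at infinity, while the
number of turns grows as `η` decreases. But each turn uses up an area `η` of the base,
which makes the following fibres smaller. After a number of turns that depends only on `a` this gain
exceeds the width of the ribbon, and from there on the image lies in `X × ℂ` itself
(`FoldData.level_bounds_of_le`). Errors occur only in the first turns, which stay in a part of the
last factor that is bounded independently of `η` (`FoldData.norm_fold_two_le`).
-/

/-! ### Symplectic and area-preserving maps -/

/-- `f` is smooth near `z` and its derivative at `z` preserves the standard symplectic form. -/
def IsSymplecticAt {n : ℕ} (f : (Fin n → ℂ) → (Fin n → ℂ)) (z : Fin n → ℂ) : Prop :=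
  ContDiffAt ℝ ∞ f z ∧
    ∀ v w, stdSymplectic (fderiv ℝ f z v) (fderiv ℝ f z w) = stdSymplectic v w

/-- The standard area form `dx ∧ dy` on `ℂ`. -/
def areaForm (v w : ℂ) : ℝ := v.re * w.im - v.im * w.re

/-- `g` is smooth near `z` and its derivative at `z` preserves the area form of `ℂ`. -/
def IsAreaPreservingAt (g : ℂ → ℂ) (z : ℂ) : Prop :=
  ContDiffAt ℝ ∞ g z ∧ ∀ v w, areaForm (fderiv ℝ g z v) (fderiv ℝ g z w) = areaForm v w

theorem IsSymplecticAt.comp {n : ℕ} {f g : (Fin n → ℂ) → (Fin n → ℂ)} {z : Fin n → ℂ}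
    (hg : IsSymplecticAt g (f z)) (hf : IsSymplecticAt f z) :
    IsSymplecticAt (fun x => g (f x)) z := by
  refine ⟨hg.1.comp z hf.1, fun v w => ?_⟩
  have h := fderiv_comp z (hg.1.differentiableAt (by simp)) (hf.1.differentiableAt (by simp))
  have h' : fderiv ℝ (fun x => g (f x)) z = (fderiv ℝ g (f z)).comp (fderiv ℝ f z) := h
  rw [h']
  simp only [ContinuousLinearMap.comp_apply]
  rw [hg.2, hf.2]

theorem IsAreaPreservingAt.comp {f g : ℂ → ℂ} {z : ℂ}
    (hg : IsAreaPreservingAt g (f z)) (hf : IsAreaPreservingAt f z) :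
    IsAreaPreservingAt (fun x => g (f x)) z := by
  refine ⟨hg.1.comp z hf.1, fun v w => ?_⟩
  have h := fderiv_comp z (hg.1.differentiableAt (by simp)) (hf.1.differentiableAt (by simp))
  have h' : fderiv ℝ (fun x => g (f x)) z = (fderiv ℝ g (f z)).comp (fderiv ℝ f z) := h
  rw [h']
  simp only [ContinuousLinearMap.comp_apply]
  rw [hg.2, hf.2]

theorem IsSymplecticAt.congr {n : ℕ} {f g : (Fin n → ℂ) → (Fin n → ℂ)} {z : Fin n → ℂ}
    (hf : IsSymplecticAt f z) (h : g =ᶠ[𝓝 z] f) : IsSymplecticAt g z := by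
  refine ⟨hf.1.congr_of_eventuallyEq h, fun v w => ?_⟩
  rw [h.fderiv_eq, hf.2]

theorem isAreaPreservingAt_id (z : ℂ) : IsAreaPreservingAt (fun x => x) z := by
  refine ⟨contDiffAt_id, fun v w => ?_⟩
  simp

/-- A product of area-preserving planar maps is symplectic. -/
theorem isSymplecticAt_pi {n : ℕ} {g : Fin n → ℂ → ℂ} {z : Fin n → ℂ}
    (h : ∀ i, IsAreaPreservingAt (g i) (z i)) : IsSymplecticAt (fun x i => g i (x i)) z := by
  have hd : ∀ i, HasFDerivAt (fun x : Fin n → ℂ => g i (x i))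
      ((fderiv ℝ (g i) (z i)).comp (ContinuousLinearMap.proj (R := ℝ) (φ := fun _ => ℂ) i)) z := by
    intro i
    exact HasFDerivAt.comp z ((h i).1.differentiableAt (by simp)).hasFDerivAt
      (ContinuousLinearMap.proj (R := ℝ) (φ := fun _ : Fin n => ℂ) i).hasFDerivAt
  refine ⟨contDiffAt_pi.2 fun i => ?_, fun v w => ?_⟩
  · exact ContDiffAt.comp z (h i).1
      (ContinuousLinearMap.proj (R := ℝ) (φ := fun _ : Fin n => ℂ) i).contDiff.contDiffAt
  · rw [(hasFDerivAt_pi.2 hd).fderiv]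
    unfold stdSymplectic
    refine Finset.sum_congr rfl fun i _ => ?_
    exact (h i).2 (v i) (w i)

theorem re_ofReal_add_ofReal_mul_I (a b : ℝ) : ((a : ℂ) + (b : ℂ) * Complex.I).re = a := by
  simp

theorem im_ofReal_add_ofReal_mul_I (a b : ℝ) : ((a : ℂ) + (b : ℂ) * Complex.I).im = b := by
  simp

/-- The Jacobian criterion for planar maps. -/
theorem isAreaPreservingAt_of_jacobian {A B : ℂ → ℝ} {z : ℂ} {a₁ a₂ b₁ b₂ : ℝ}
    (hA : ContDiffAt ℝ ∞ A z) (hB : ContDiffAt ℝ ∞ B z)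
    (hA' : HasFDerivAt A (a₁ • Complex.reCLM + a₂ • Complex.imCLM) z)
    (hB' : HasFDerivAt B (b₁ • Complex.reCLM + b₂ • Complex.imCLM) z)
    (h : a₁ * b₂ - a₂ * b₁ = 1) :
    IsAreaPreservingAt (fun x => (A x : ℂ) + (B x : ℂ) * Complex.I) z := by
  have hc : ∀ {F : ℂ → ℝ}, ContDiffAt ℝ ∞ F z → ContDiffAt ℝ ∞ (fun x => (F x : ℂ)) z :=
    fun hF => Complex.ofRealCLM.contDiff.contDiffAt.comp z hF
  refine ⟨(hc hA).add ((hc hB).mul contDiffAt_const), fun v w => ?_⟩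
  have hd := ((Complex.ofRealCLM.hasFDerivAt (x := A z)).comp z hA').add
    (((Complex.ofRealCLM.hasFDerivAt (x := B z)).comp z hB').mul_const Complex.I)
  have hd' : fderiv ℝ (fun x => (A x : ℂ) + (B x : ℂ) * Complex.I) z = _ := hd.fderiv
  rw [hd']
  simp [areaForm]
  linear_combination (v.re * w.im - v.im * w.re) * h

/-- A perturbation of the identity of `ℂ³` is symplectic as soon as its linearization is. -/
theorem isSymplecticAt_id_add {P Q R : (Fin 3 → ℂ) → ℂ} {P' Q' R' : (Fin 3 → ℂ) →L[ℝ] ℂ}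
    {z : Fin 3 → ℂ} (hP : ContDiffAt ℝ ∞ P z) (hQ : ContDiffAt ℝ ∞ Q z) (hR : ContDiffAt ℝ ∞ R z)
    (hP' : HasFDerivAt P P' z) (hQ' : HasFDerivAt Q Q' z) (hR' : HasFDerivAt R R' z)
    (h : ∀ v w : Fin 3 → ℂ, stdSymplectic (fun i => v i + (![P' v, Q' v, R' v] : Fin 3 → ℂ) i)
      (fun i => w i + (![P' w, Q' w, R' w] : Fin 3 → ℂ) i) = stdSymplectic v w) :
    IsSymplecticAt (fun x i => x i + (![P x, Q x, R x] : Fin 3 → ℂ) i) z := by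
  have hd : HasFDerivAt (fun (x : Fin 3 → ℂ) i => x i + (![P x, Q x, R x] : Fin 3 → ℂ) i)
      (ContinuousLinearMap.pi fun i =>
        ContinuousLinearMap.proj (R := ℝ) (φ := fun _ => ℂ) i
          + (![P', Q', R'] : Fin 3 → (Fin 3 → ℂ) →L[ℝ] ℂ) i) z := by
    refine hasFDerivAt_pi.2 fun i =>
      (ContinuousLinearMap.proj (R := ℝ) (φ := fun _ : Fin 3 => ℂ) i).hasFDerivAt.add ?_
    fin_cases i
    exacts [hP', hQ', hR']
  refine ⟨contDiffAt_pi.2 fun i => ContDiffAt.add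
    (ContinuousLinearMap.proj (R := ℝ) (φ := fun _ : Fin 3 => ℂ) i).contDiff.contDiffAt ?_,
    fun v w => ?_⟩
  · fin_cases i
    exacts [hP, hQ, hR]
  · rw [hd.fderiv, ← h v w]
    simp [stdSymplectic, Fin.sum_univ_three]

/-! ### A smooth ramp -/

/-- A smooth step that is `0` on `(-∞, 0]` and `1` on `[d, ∞)`. -/
noncomputable def smoothStep (d x : ℝ) : ℝ := Real.smoothTransition (x / d)

/-- A smooth version of `max x 0`, with derivative `smoothStep d`. -/
noncomputable def smoothRamp (d x : ℝ) : ℝ := ∫ s in (0 : ℝ)..x, smoothStep d s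

theorem contDiff_smoothStep (d : ℝ) : ContDiff ℝ ∞ (smoothStep d) :=
  Real.smoothTransition.contDiff.comp (contDiff_id.div_const d)

theorem smoothStep_nonneg (d x : ℝ) : 0 ≤ smoothStep d x := Real.smoothTransition.nonneg _

theorem smoothStep_le_one (d x : ℝ) : smoothStep d x ≤ 1 := Real.smoothTransition.le_one _

theorem smoothStep_of_nonpos {d x : ℝ} (hd : 0 < d) (hx : x ≤ 0) : smoothStep d x = 0 :=
  Real.smoothTransition.zero_of_nonpos (div_nonpos_of_nonpos_of_nonneg hx hd.le)

theorem smoothStep_of_le {d x : ℝ} (hd : 0 < d) (hx : d ≤ x) : smoothStep d x = 1 :=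
  Real.smoothTransition.one_of_one_le ((one_le_div hd).2 hx)

theorem hasDerivAt_smoothRamp (d x : ℝ) : HasDerivAt (smoothRamp d) (smoothStep d x) x :=
  intervalIntegral.integral_hasDerivAt_right
    ((contDiff_smoothStep d).continuous.intervalIntegrable _ _)
    ((contDiff_smoothStep d).continuous.stronglyMeasurableAtFilter _ _)
    (contDiff_smoothStep d).continuous.continuousAt

theorem contDiff_smoothRamp (d : ℝ) : ContDiff ℝ ∞ (smoothRamp d) := by
  rw [contDiff_infty_iff_deriv]
  refine ⟨fun x => (hasDerivAt_smoothRamp d x).differentiableAt, ?_⟩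
  have : deriv (smoothRamp d) = smoothStep d := funext fun x => (hasDerivAt_smoothRamp d x).deriv
  rw [this]
  exact contDiff_smoothStep d

theorem smoothRamp_of_nonpos {d x : ℝ} (hd : 0 < d) (hx : x ≤ 0) : smoothRamp d x = 0 := by
  unfold smoothRamp
  rw [intervalIntegral.integral_congr (g := fun _ => (0 : ℝ))]
  · simp
  · intro s hs
    rw [Set.uIcc_of_ge hx] at hs
    exact smoothStep_of_nonpos hd hs.2

theorem monotone_smoothRamp (d : ℝ) : Monotone (smoothRamp d) :=
  monotone_of_hasDerivAt_nonneg (hasDerivAt_smoothRamp d) (smoothStep_nonneg d)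

theorem smoothRamp_nonneg {d : ℝ} (hd : 0 < d) (x : ℝ) : 0 ≤ smoothRamp d x := by
  rcases le_total x 0 with h | h
  · rw [smoothRamp_of_nonpos hd h]
  · simpa [smoothRamp] using monotone_smoothRamp d h

/-- `x - smoothRamp d x` is monotone as well. -/
theorem monotone_sub_smoothRamp (d : ℝ) : Monotone fun x => x - smoothRamp d x :=
  monotone_of_hasDerivAt_nonneg (fun x => (hasDerivAt_id x).sub (hasDerivAt_smoothRamp d x))
    fun x => sub_nonneg.2 (smoothStep_le_one d x)

theorem smoothRamp_le_self {d x : ℝ} (hx : 0 ≤ x) : smoothRamp d x ≤ x := by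
  have := monotone_sub_smoothRamp d hx
  simp only [smoothRamp, intervalIntegral.integral_same] at this ⊢
  linarith

theorem smoothRamp_le_max {d : ℝ} (hd : 0 < d) (x : ℝ) : smoothRamp d x ≤ max x 0 := by
  rcases le_total x 0 with h | h
  · rw [smoothRamp_of_nonpos hd h]; exact le_max_right _ _
  · exact (smoothRamp_le_self h).trans (le_max_left _ _)

theorem sub_le_smoothRamp {d : ℝ} (hd : 0 < d) (x : ℝ) : x - d ≤ smoothRamp d x := by
  rcases le_total x d with h | h
  · linarith [smoothRamp_nonneg hd x]
  · have h1 : MonotoneOn (fun x => smoothRamp d x - x) (Set.Ici d) := by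
      refine monotoneOn_of_deriv_nonneg (convex_Ici d)
        ((contDiff_smoothRamp d).continuous.sub continuous_id).continuousOn
        (fun y _ => ((hasDerivAt_smoothRamp d y).sub
          (hasDerivAt_id y)).differentiableAt.differentiableWithinAt) fun y hy => ?_
      rw [interior_Ici] at hy
      have := ((hasDerivAt_smoothRamp d y).sub (hasDerivAt_id y)).deriv
      have h2 : deriv (fun x => smoothRamp d x - x) y = smoothStep d y - 1 := this
      rw [h2, smoothStep_of_le hd (le_of_lt hy)]
      simp
    have := h1 (Set.mem_Ici.2 le_rfl) (Set.mem_Ici.2 h) h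
    simp only at this
    linarith [smoothRamp_nonneg hd d]

/-! ### The disc in a half-strip -/

/-- The radial factor in the passage from `ℂ` to the half-plane. -/
noncomputable def halfPlaneFactor (k : ℝ) (z : ℂ) : ℝ := √(k + (z.re ^ 2 + z.im ^ 2) / 4)

/-- The height of the image of `z` in the half-plane. -/
noncomputable def halfPlaneHeight (k : ℝ) (z : ℂ) : ℝ :=
  k + (z.re ^ 2 + z.im ^ 2) / 2 + z.re * halfPlaneFactor k z

/-- The horizontal coordinate of the image of `z` in the half-plane. -/
noncomputable def halfPlaneSlope (k : ℝ) (z : ℂ) : ℝ :=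
  z.im * halfPlaneFactor k z / halfPlaneHeight k z

/-- The symplectomorphism from `ℂ` onto the half-plane `{p + q i : p > 0}` that carries rotations
to the hyperbolic rotations generated by `(p (1 + q²) + k² / p) / 2`. -/
noncomputable def toHalfPlane (k : ℝ) (z : ℂ) : ℂ :=
  (halfPlaneHeight k z : ℂ) + (halfPlaneSlope k z : ℂ) * Complex.I

/-- The area-preserving map `(p, q) ↦ (π p (1 + q²), 1 / 2 + arctan q / π)` from the half-plane to
the half-strip `(0, ∞) × (0, 1)`. -/
noncomputable def halfPlaneToStrip (z : ℂ) : ℂ :=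
  ((Real.pi * (z.re * (1 + z.im ^ 2)) : ℝ) : ℂ)
    + ((1 / 2 + Real.arctan z.im / Real.pi : ℝ) : ℂ) * Complex.I

/-- An area-preserving embedding of `ℂ` into the half-strip `(0, ∞) × (0, 1)` which takes each
disc `{π |z|² ≤ t}` into `(0, t + 2 π k) × (0, 1)`. -/
noncomputable def toStrip (k : ℝ) (z : ℂ) : ℂ := halfPlaneToStrip (toHalfPlane k z)

section

variable {k : ℝ} (hk : 0 < k) (z : ℂ)

include hk

theorem halfPlaneFactor_sq : halfPlaneFactor k z ^ 2 = k + (z.re ^ 2 + z.im ^ 2) / 4 :=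
  Real.sq_sqrt (by positivity)

theorem halfPlaneFactor_pos : 0 < halfPlaneFactor k z := Real.sqrt_pos.2 (by positivity)

theorem halfPlaneHeight_eq :
    halfPlaneHeight k z = (halfPlaneFactor k z + z.re / 2) ^ 2 + z.im ^ 2 / 4 := by
  have := halfPlaneFactor_sq hk z
  unfold halfPlaneHeight
  linear_combination (-1 : ℝ) * this

theorem halfPlaneHeight_pos : 0 < halfPlaneHeight k z := by
  have h1 := halfPlaneFactor_sq hk z
  have h2 := halfPlaneFactor_pos hk z
  have h3 : 0 < halfPlaneFactor k z + z.re / 2 := by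
    by_contra hcon
    push Not at hcon
    nlinarith [sq_nonneg z.im]
  rw [halfPlaneHeight_eq hk]
  positivity

theorem contDiff_halfPlaneFactor : ContDiff ℝ ∞ (halfPlaneFactor k) := by
  refine ContDiff.sqrt ?_ fun z => by positivity
  exact contDiff_const.add
    (((Complex.reCLM.contDiff.pow 2).add (Complex.imCLM.contDiff.pow 2)).div_const 4)

theorem contDiff_halfPlaneHeight : ContDiff ℝ ∞ (halfPlaneHeight k) :=
  (contDiff_const.add
    (((Complex.reCLM.contDiff.pow 2).add (Complex.imCLM.contDiff.pow 2)).div_const 2)).add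
    (Complex.reCLM.contDiff.mul (contDiff_halfPlaneFactor hk))

theorem contDiff_halfPlaneSlope : ContDiff ℝ ∞ (halfPlaneSlope k) :=
  (Complex.imCLM.contDiff.mul (contDiff_halfPlaneFactor hk)).div (contDiff_halfPlaneHeight hk)
    fun z => (halfPlaneHeight_pos hk z).ne'

theorem hasFDerivAt_halfPlaneFactor :
    HasFDerivAt (halfPlaneFactor k) ((z.re / (4 * halfPlaneFactor k z)) • Complex.reCLM
      + (z.im / (4 * halfPlaneFactor k z)) • Complex.imCLM) z := by
  have hr : HasFDerivAt Complex.re Complex.reCLM z := Complex.reCLM.hasFDerivAt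
  have hi : HasFDerivAt Complex.im Complex.imCLM z := Complex.imCLM.hasFDerivAt
  have h := ((((hr.pow 2).add (hi.pow 2)).mul_const (1 / 4)).const_add k).sqrt
    (by simp only [Pi.add_apply]; positivity)
  have h2 := halfPlaneFactor_pos hk z
  refine (h.congr_of_eventuallyEq (Filter.Eventually.of_forall fun x => ?_)).congr_fderiv ?_
  · simp [halfPlaneFactor, div_eq_mul_inv]
  · have e : √(k + (z.re ^ 2 + z.im ^ 2) / 4) = halfPlaneFactor k z := rfl
    ext v
    simp [← div_eq_mul_inv]
    rw [e]
    field_simp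

theorem isAreaPreservingAt_toHalfPlane : IsAreaPreservingAt (toHalfPlane k) z := by
  have hr : HasFDerivAt Complex.re Complex.reCLM z := Complex.reCLM.hasFDerivAt
  have hi : HasFDerivAt Complex.im Complex.imCLM z := Complex.imCLM.hasFDerivAt
  have hg := hasFDerivAt_halfPlaneFactor hk z
  have gp := halfPlaneFactor_pos hk z
  have pp := halfPlaneHeight_pos hk z
  have gs := halfPlaneFactor_sq hk z
  set g := halfPlaneFactor k z with hgdef
  set p := halfPlaneHeight k z with hpdef
  have pe : p = k + (z.re ^ 2 + z.im ^ 2) / 2 + z.re * g := rfl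
  have hp : HasFDerivAt (halfPlaneHeight k)
      ((z.re + g + z.re ^ 2 / (4 * g)) • Complex.reCLM
        + (z.im + z.re * z.im / (4 * g)) • Complex.imCLM) z := by
    have h := ((((hr.pow 2).add (hi.pow 2)).mul_const (1 / 2)).const_add k).add (hr.mul hg)
    refine (h.congr_of_eventuallyEq (Filter.Eventually.of_forall fun x => ?_)).congr_fderiv ?_
    · simp [halfPlaneHeight, div_eq_mul_inv]
    · ext v
      simp [← hgdef]
      field_simp
      ring
  have hq : HasFDerivAt (halfPlaneSlope k)
      ((z.re * z.im / (4 * g) / p - z.im * g / p ^ 2 * (z.re + g + z.re ^ 2 / (4 * g)))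
          • Complex.reCLM
        + ((g + z.im ^ 2 / (4 * g)) / p - z.im * g / p ^ 2 * (z.im + z.re * z.im / (4 * g)))
          • Complex.imCLM) z := by
    have h := (hi.mul hg).mul ((hasDerivAt_inv pp.ne').comp_hasFDerivAt z hp)
    refine (h.congr_of_eventuallyEq (Filter.Eventually.of_forall fun x => ?_)).congr_fderiv ?_
    · simp [halfPlaneSlope, div_eq_mul_inv]
    · ext v
      simp [← hgdef, ← hpdef]
      field_simp
      ring
  refine isAreaPreservingAt_of_jacobian (contDiff_halfPlaneHeight hk).contDiffAt
    (contDiff_halfPlaneSlope hk).contDiffAt hp hq ?_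
  have key : z.re * g + g ^ 2 + (z.re ^ 2 + z.im ^ 2) / 4 = p := by
    linear_combination gs - pe
  have e : (z.re + g + z.re ^ 2 / (4 * g)) * (g + z.im ^ 2 / (4 * g))
      - (z.im + z.re * z.im / (4 * g)) * (z.re * z.im / (4 * g)) = p := by
    rw [← key]
    field_simp
    ring
  have e2 : (z.re + g + z.re ^ 2 / (4 * g)) * (g + z.im ^ 2 / (4 * g)) / p
      - (z.im + z.re * z.im / (4 * g)) * (z.re * z.im / (4 * g)) / p = 1 := by
    rw [← sub_div, e, div_self pp.ne']
  linear_combination e2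

theorem toHalfPlane_injective : Function.Injective (toHalfPlane k) := by
  have main : ∀ z : ℂ, halfPlaneHeight k z * (2 * (k + (z.re ^ 2 + z.im ^ 2) / 2)
      - halfPlaneHeight k z) = (z.im * halfPlaneFactor k z) ^ 2 + k ^ 2 := by
    intro z
    have := halfPlaneFactor_sq hk z
    unfold halfPlaneHeight
    linear_combination (-(z.re ^ 2 + z.im ^ 2)) * this
  intro z w hzw
  have h1 : halfPlaneHeight k z = halfPlaneHeight k w := by
    simpa [toHalfPlane] using congrArg Complex.re hzw
  have h2 : halfPlaneSlope k z = halfPlaneSlope k w := by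
    simpa [toHalfPlane] using congrArg Complex.im hzw
  have pz := halfPlaneHeight_pos hk z
  have h3 : z.im * halfPlaneFactor k z = w.im * halfPlaneFactor k w := by
    unfold halfPlaneSlope at h2
    rw [h1] at h2 pz
    field_simp at h2
    exact h2
  have h4 : z.re ^ 2 + z.im ^ 2 = w.re ^ 2 + w.im ^ 2 := by
    have e1 := main z
    have e2 := main w
    rw [h3, ← e2, h1] at e1
    rw [h1] at pz
    have := mul_left_cancel₀ pz.ne' e1
    linarith
  have h5 : halfPlaneFactor k z = halfPlaneFactor k w := by
    unfold halfPlaneFactor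
    rw [h4]
  have gp := halfPlaneFactor_pos hk w
  rw [h5] at h3
  have h6 : z.re * halfPlaneFactor k w = w.re * halfPlaneFactor k w := by
    unfold halfPlaneHeight at h1
    rw [h5, h4] at h1
    linarith
  exact Complex.ext (mul_right_cancel₀ gp.ne' h6) (mul_right_cancel₀ gp.ne' h3)

end

theorem isAreaPreservingAt_halfPlaneToStrip (z : ℂ) :
    IsAreaPreservingAt halfPlaneToStrip z := by
  have hr : HasFDerivAt Complex.re Complex.reCLM z := Complex.reCLM.hasFDerivAt
  have hi : HasFDerivAt Complex.im Complex.imCLM z := Complex.imCLM.hasFDerivAt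
  have hpi := Real.pi_pos
  have hA : HasFDerivAt (fun z : ℂ => Real.pi * (z.re * (1 + z.im ^ 2)))
      ((Real.pi * (1 + z.im ^ 2)) • Complex.reCLM
        + (Real.pi * (z.re * (2 * z.im))) • Complex.imCLM) z := by
    refine ((hr.mul ((hi.pow 2).const_add 1)).const_mul Real.pi).congr_fderiv ?_
    ext v
    simp
    ring
  have hB : HasFDerivAt (fun z : ℂ => 1 / 2 + Real.arctan z.im / Real.pi)
      ((0 : ℝ) • Complex.reCLM + (1 / (1 + z.im ^ 2) / Real.pi) • Complex.imCLM) z := by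
    have h := ((((Real.hasDerivAt_arctan z.im).comp_hasFDerivAt z hi).mul_const
      (1 / Real.pi)).const_add (1 / 2))
    refine (h.congr_of_eventuallyEq (Filter.Eventually.of_forall fun x => ?_)).congr_fderiv ?_
    · simp [div_eq_mul_inv]
    · ext v
      simp
      field_simp
  refine isAreaPreservingAt_of_jacobian ?_ ?_ hA hB ?_
  · exact (contDiff_const.mul (Complex.reCLM.contDiff.mul
      (contDiff_const.add (Complex.imCLM.contDiff.pow 2)))).contDiffAt
  · exact (contDiff_const.add
      ((Real.contDiff_arctan.comp Complex.imCLM.contDiff).div_const _)).contDiffAt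
  · field_simp
    ring

theorem halfPlaneToStrip_re (z : ℂ) :
    (halfPlaneToStrip z).re = Real.pi * (z.re * (1 + z.im ^ 2)) :=
  re_ofReal_add_ofReal_mul_I _ _

theorem halfPlaneToStrip_im (z : ℂ) :
    (halfPlaneToStrip z).im = 1 / 2 + Real.arctan z.im / Real.pi :=
  im_ofReal_add_ofReal_mul_I _ _

theorem halfPlaneToStrip_injective : Function.Injective halfPlaneToStrip := by
  intro z w h
  have h1 := congrArg Complex.re h
  have h2 := congrArg Complex.im h
  rw [halfPlaneToStrip_re, halfPlaneToStrip_re] at h1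
  rw [halfPlaneToStrip_im, halfPlaneToStrip_im] at h2
  have h3 : z.im = w.im := by
    apply Real.arctan_injective
    have := Real.pi_pos
    field_simp at h2
    linarith
  rw [h3] at h1
  refine Complex.ext ?_ h3
  have : 0 < 1 + w.im ^ 2 := by positivity
  exact mul_right_cancel₀ this.ne' (mul_left_cancel₀ Real.pi_pos.ne' h1)

section

variable {k : ℝ} (hk : 0 < k) (z : ℂ)

include hk

theorem isAreaPreservingAt_toStrip : IsAreaPreservingAt (toStrip k) z :=
  (isAreaPreservingAt_halfPlaneToStrip _).comp (isAreaPreservingAt_toHalfPlane hk z)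

theorem toStrip_injective : Function.Injective (toStrip k) :=
  halfPlaneToStrip_injective.comp (toHalfPlane_injective hk)

theorem continuous_toStrip : Continuous (toStrip k) :=
  continuous_iff_continuousAt.2 fun z => (isAreaPreservingAt_toStrip hk z).1.continuousAt

theorem toStrip_re_pos : 0 < (toStrip k z).re := by
  have := halfPlaneHeight_pos hk z
  have := Real.pi_pos
  rw [toStrip, halfPlaneToStrip_re, toHalfPlane, re_ofReal_add_ofReal_mul_I,
    im_ofReal_add_ofReal_mul_I]
  positivity

theorem toStrip_re_lt : (toStrip k z).re < Real.pi * ‖z‖ ^ 2 + 2 * Real.pi * k := by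
  have hp := halfPlaneHeight_pos hk z
  have hg := halfPlaneFactor_sq hk z
  have hpi := Real.pi_pos
  have e : halfPlaneHeight k z * (1 + halfPlaneSlope k z ^ 2)
      = z.re ^ 2 + z.im ^ 2 + 2 * k - k ^ 2 / halfPlaneHeight k z := by
    unfold halfPlaneSlope
    field_simp
    unfold halfPlaneHeight
    linear_combination (z.re ^ 2 + z.im ^ 2) * hg
  have hn : ‖z‖ ^ 2 = z.re ^ 2 + z.im ^ 2 := by
    rw [Complex.sq_norm, Complex.normSq_apply]
    ring
  have e2 : (toStrip k z).re
      = Real.pi * (halfPlaneHeight k z * (1 + halfPlaneSlope k z ^ 2)) := by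
    rw [toStrip, halfPlaneToStrip_re, toHalfPlane, re_ofReal_add_ofReal_mul_I,
      im_ofReal_add_ofReal_mul_I]
  have : 0 < k ^ 2 / halfPlaneHeight k z := by positivity
  rw [e2, e, hn]
  nlinarith

omit hk in
theorem toStrip_im_mem : (toStrip k z).im ∈ Set.Ioo (0 : ℝ) 1 := by
  have hpi := Real.pi_pos
  have h1 := Real.neg_pi_div_two_lt_arctan (toHalfPlane k z).im
  have h2 := Real.arctan_lt_pi_div_two (toHalfPlane k z).im
  have e : (toStrip k z).im = 1 / 2 + Real.arctan (toHalfPlane k z).im / Real.pi :=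
    halfPlaneToStrip_im _
  rw [e]
  constructor
  · have : -(1 / 2) < Real.arctan (toHalfPlane k z).im / Real.pi := by
      rw [lt_div_iff₀ hpi]; linarith
    linarith
  · have : Real.arctan (toHalfPlane k z).im / Real.pi < 1 / 2 := by
      rw [div_lt_iff₀ hpi]; linarith
    linarith

end

/-! ### Polar coordinates -/

/-- Action-angle coordinates: the point with `π |z|² = t` and argument `2 π θ`, for `t + θ i`. -/
noncomputable def fromPolar (x : ℂ) : ℂ :=
  ((√(x.re / Real.pi) * Real.cos (2 * Real.pi * x.im) : ℝ) : ℂ)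
    + ((√(x.re / Real.pi) * Real.sin (2 * Real.pi * x.im) : ℝ) : ℂ) * Complex.I

theorem norm_sq_fromPolar {x : ℂ} (hx : 0 ≤ x.re) : Real.pi * ‖fromPolar x‖ ^ 2 = x.re := by
  have hpi := Real.pi_pos
  have h1 : √(x.re / Real.pi) ^ 2 = x.re / Real.pi := Real.sq_sqrt (by positivity)
  have h2 := Real.sin_sq_add_cos_sq (2 * Real.pi * x.im)
  have e : ‖fromPolar x‖ ^ 2 = x.re / Real.pi := by
    rw [Complex.sq_norm, Complex.normSq_apply, ← h1, fromPolar, re_ofReal_add_ofReal_mul_I,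
      im_ofReal_add_ofReal_mul_I]
    linear_combination √(x.re / Real.pi) ^ 2 * h2
  rw [e]
  field_simp

theorem isAreaPreservingAt_fromPolar {x : ℂ} (hx : 0 < x.re) : IsAreaPreservingAt fromPolar x := by
  have hpi := Real.pi_pos
  have hr : HasFDerivAt Complex.re Complex.reCLM x := Complex.reCLM.hasFDerivAt
  have hi : HasFDerivAt Complex.im Complex.imCLM x := Complex.imCLM.hasFDerivAt
  have hpos : 0 < x.re / Real.pi := by positivity
  have hr0 := Real.sqrt_pos.2 hpos
  have hr2 : √(x.re / Real.pi) ^ 2 = x.re / Real.pi := Real.sq_sqrt hpos.le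
  have hs := (hr.mul_const (1 / Real.pi)).sqrt (by simpa [div_eq_mul_inv] using hpos.ne')
  simp only [one_div, ← div_eq_mul_inv] at hs
  have hc := (Real.hasDerivAt_cos (2 * Real.pi * x.im)).comp_hasFDerivAt x
    (hi.const_mul (2 * Real.pi))
  have hsn := (Real.hasDerivAt_sin (2 * Real.pi * x.im)).comp_hasFDerivAt x
    (hi.const_mul (2 * Real.pi))
  have csq : ContDiffAt ℝ ∞ (fun x : ℂ => √(x.re / Real.pi)) x :=
    (Complex.reCLM.contDiff.div_const _).contDiffAt.sqrt hpos.ne'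
  have cim : ContDiff ℝ ∞ (fun x : ℂ => 2 * Real.pi * x.im) :=
    contDiff_const.mul Complex.imCLM.contDiff
  set r := √(x.re / Real.pi) with hrdef
  set C := Real.cos (2 * Real.pi * x.im) with hC
  set S := Real.sin (2 * Real.pi * x.im) with hS
  refine isAreaPreservingAt_of_jacobian (a₁ := 1 / (2 * Real.pi * r) * C)
    (a₂ := - (r * S * (2 * Real.pi))) (b₁ := 1 / (2 * Real.pi * r) * S)
    (b₂ := r * C * (2 * Real.pi)) (csq.mul (Real.contDiff_cos.comp cim).contDiffAt)
    (csq.mul (Real.contDiff_sin.comp cim).contDiffAt) ?_ ?_ ?_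
  · refine (hs.mul hc).congr_fderiv ?_
    ext v
    simp [← hrdef, ← hC]
    field_simp
    ring
  · refine (hs.mul hsn).congr_fderiv ?_
    ext v
    simp [← hrdef, ← hS]
    field_simp
    ring
  · have h2 : S ^ 2 + C ^ 2 = 1 := Real.sin_sq_add_cos_sq _
    field_simp
    linear_combination h2

/-- `fromPolar` is injective up to integer shifts of the angle. -/
theorem fromPolar_eq {x y : ℂ} (hx : 0 < x.re) (hy : 0 < y.re) (h : fromPolar x = fromPolar y) :
    x.re = y.re ∧ ∃ n : ℤ, x.im = y.im + n := by
  have hpi := Real.pi_pos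
  have h1 : x.re = y.re := by
    rw [← norm_sq_fromPolar hx.le, ← norm_sq_fromPolar hy.le, h]
  refine ⟨h1, ?_⟩
  have hr0 := Real.sqrt_pos.2 (show 0 < y.re / Real.pi by positivity)
  have form : ∀ x : ℂ, fromPolar x
      = (√(x.re / Real.pi) : ℝ) * Complex.exp ((2 * Real.pi * x.im : ℝ) * Complex.I) := by
    intro x
    rw [Complex.exp_mul_I, ← Complex.ofReal_cos, ← Complex.ofReal_sin]
    unfold fromPolar
    push_cast
    ring
  rw [form, form, h1] at h
  have h2 := mul_left_cancel₀ (Complex.ofReal_ne_zero.2 hr0.ne') h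
  obtain ⟨n, hn⟩ := Complex.exp_eq_exp_iff_exists_int.1 h2
  refine ⟨n, ?_⟩
  have h3 := congrArg Complex.im hn
  simp at h3
  have h4 : 2 * Real.pi * x.im = 2 * Real.pi * (y.im + n) := by linarith
  exact mul_left_cancel₀ (by positivity) h4

/-! ### Elementary planar and spatial shears -/

/-- A differentiable function whose derivative is bounded below by a positive constant, as a
homeomorphism of `ℝ`. -/
noncomputable def homeomorphOfDeriv (f f' : ℝ → ℝ) (c : ℝ) (hc : 0 < c)
    (hf : ∀ x, HasDerivAt f (f' x) x) (h : ∀ x, c ≤ f' x) : ℝ ≃ₜ ℝ :=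
  (StrictMono.orderIsoOfSurjective f
    (strictMono_of_hasDerivAt_pos hf fun x => hc.trans_le (h x))
    (by
      have hm : Monotone fun x => f x - c * x := by
        refine monotone_of_hasDerivAt_nonneg (f' := fun x => f' x - c)
          (fun x => ?_) fun x => sub_nonneg.2 (h x)
        simpa using! (hf x).sub ((hasDerivAt_id x).const_mul c)
      refine Continuous.surjective
        (continuous_iff_continuousAt.2 fun x => (hf x).continuousAt) ?_ ?_
      · refine Filter.tendsto_atTop_mono' _ ?_
          (Filter.tendsto_atTop_add_const_left _ (f 0) (Filter.tendsto_id.const_mul_atTop hc))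
        filter_upwards [Filter.eventually_ge_atTop 0] with x hx
        have := hm hx
        simp only [id] at this ⊢
        linarith
      · refine Filter.tendsto_atBot_mono' _ ?_
          (Filter.tendsto_atBot_add_const_left _ (f 0) (Filter.tendsto_id.const_mul_atBot hc))
        filter_upwards [Filter.eventually_le_atBot 0] with x hx
        have := hm hx
        simp only [id] at this ⊢
        linarith)).toHomeomorph

theorem contDiff_of_hasDerivAt {f f' : ℝ → ℝ} (hf : ∀ x, HasDerivAt f (f' x) x)
    (hf' : ContDiff ℝ ∞ f') : ContDiff ℝ ∞ f := by
  rw [contDiff_infty_iff_deriv]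
  refine ⟨fun x => (hf x).differentiableAt, ?_⟩
  rwa [show deriv f = f' from funext fun x => (hf x).deriv]

/-- The stretch `(x, y) ↦ (f y, -x / f' y)` is area preserving. -/
theorem isAreaPreservingAt_stretch {f f' : ℝ → ℝ} (hf : ∀ x, HasDerivAt f (f' x) x)
    (hf' : ContDiff ℝ ∞ f') (h0 : ∀ x, f' x ≠ 0) (z : ℂ) :
    IsAreaPreservingAt
      (fun z => ((f z.im : ℝ) : ℂ) + ((-z.re / f' z.im : ℝ) : ℂ) * Complex.I) z := by
  have hr : HasFDerivAt Complex.re Complex.reCLM z := Complex.reCLM.hasFDerivAt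
  have hi : HasFDerivAt Complex.im Complex.imCLM z := Complex.imCLM.hasFDerivAt
  have hd := ((hf'.differentiable (by simp)) z.im).hasDerivAt
  have hne := h0 z.im
  refine isAreaPreservingAt_of_jacobian (a₁ := 0) (a₂ := f' z.im) (b₁ := -1 / f' z.im)
    (b₂ := z.re * deriv f' z.im / f' z.im ^ 2)
    ((contDiff_of_hasDerivAt hf hf').comp Complex.imCLM.contDiff).contDiffAt
    ((Complex.reCLM.contDiff.neg.div (hf'.comp Complex.imCLM.contDiff)
      fun z => h0 z.im).contDiffAt) ?_ ?_ ?_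
  · refine ((hf z.im).comp_hasFDerivAt z hi).congr_fderiv ?_
    ext v
    simp
  · have h := hr.neg.mul ((hd.fun_inv hne).comp_hasFDerivAt z hi)
    refine (h.congr_of_eventuallyEq (Filter.Eventually.of_forall fun x => ?_)).congr_fderiv ?_
    · simp [div_eq_mul_inv]
    · ext v
      simp
      field_simp
      ring
  · field_simp
    ring

/-- With `e` a change of coordinate on the line, `u = e⁻¹ x`, the map
`(x, y) ↦ (g u - y e'(u), u)` is area preserving. -/
theorem isAreaPreservingAt_bend {e : ℝ ≃ₜ ℝ} {f' g : ℝ → ℝ} (he : ∀ x, HasDerivAt e (f' x) x)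
    (hf' : ContDiff ℝ ∞ f') (h0 : ∀ x, f' x ≠ 0) (hg : ContDiff ℝ ∞ g) (z : ℂ) :
    IsAreaPreservingAt
      (fun z => ((g (e.symm z.re) - z.im * f' (e.symm z.re) : ℝ) : ℂ)
        + ((e.symm z.re : ℝ) : ℂ) * Complex.I) z := by
  have hr : HasFDerivAt Complex.re Complex.reCLM z := Complex.reCLM.hasFDerivAt
  have hi : HasFDerivAt Complex.im Complex.imCLM z := Complex.imCLM.hasFDerivAt
  have hs : ContDiff ℝ ∞ e.symm :=
    e.contDiff_symm_deriv h0 he (contDiff_of_hasDerivAt he hf')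
  have hs' : HasDerivAt e.symm (f' (e.symm z.re))⁻¹ z.re := by
    refine HasDerivAt.of_local_left_inverse (f := e) e.symm.continuous.continuousAt
      (he _) (h0 _) (Filter.Eventually.of_forall fun y => ?_)
    exact e.apply_symm_apply y
  have hd := ((hf'.differentiable (by simp)) (e.symm z.re)).hasDerivAt
  have hgd := ((hg.differentiable (by simp)) (e.symm z.re)).hasDerivAt
  have hne := h0 (e.symm z.re)
  have hu : HasFDerivAt (fun z : ℂ => e.symm z.re) ((f' (e.symm z.re))⁻¹ • Complex.reCLM) z :=
    hs'.comp_hasFDerivAt z hr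
  have cu : ContDiff ℝ ∞ (fun z : ℂ => e.symm z.re) := hs.comp Complex.reCLM.contDiff
  refine isAreaPreservingAt_of_jacobian
    (a₁ := (deriv g (e.symm z.re) - z.im * deriv f' (e.symm z.re)) * (f' (e.symm z.re))⁻¹)
    (a₂ := - f' (e.symm z.re)) (b₁ := (f' (e.symm z.re))⁻¹) (b₂ := 0)
    ((hg.comp cu).sub (Complex.imCLM.contDiff.mul (hf'.comp cu))).contDiffAt
    cu.contDiffAt ?_ ?_ ?_
  · refine ((hgd.comp_hasFDerivAt z hu).sub
      (hi.mul (hd.comp_hasFDerivAt z hu))).congr_fderiv ?_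
    ext v
    simp
    ring
  · refine hu.congr_fderiv ?_
    ext v
    simp
  · field_simp
    ring

theorem isAreaPreservingAt_shear {f : ℝ → ℝ} (hf : ContDiff ℝ ∞ f) (z : ℂ) :
    IsAreaPreservingAt
      (fun z => ((z.re + f z.im : ℝ) : ℂ) + ((z.im : ℝ) : ℂ) * Complex.I) z := by
  have hr : HasFDerivAt Complex.re Complex.reCLM z := Complex.reCLM.hasFDerivAt
  have hi : HasFDerivAt Complex.im Complex.imCLM z := Complex.imCLM.hasFDerivAt
  have hd := ((hf.differentiable (by simp)) z.im).hasDerivAt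
  refine isAreaPreservingAt_of_jacobian (a₁ := 1) (a₂ := deriv f z.im) (b₁ := 0) (b₂ := 1)
    (Complex.reCLM.contDiff.add (hf.comp Complex.imCLM.contDiff)).contDiffAt
    Complex.imCLM.contDiff.contDiffAt ?_ ?_ ?_
  · refine (hr.add (hd.comp_hasFDerivAt z hi)).congr_fderiv ?_
    ext v
    simp
  · refine hi.congr_fderiv ?_
    ext v
    simp
  · ring

/-- The shear of `ℂ³` with generating function `-c(x₀) x₁ + ∫ b`: the momenta `y₀` and `y₁` change
by `b(x₀) - c'(x₀) x₁` and `-c(x₀)`. -/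
noncomputable def couplingShear (c c' b : ℝ → ℝ) (z : Fin 3 → ℂ) : Fin 3 → ℂ := fun i =>
  z i + (![((b (z 0).re - c' (z 0).re * (z 1).re : ℝ) : ℂ) * Complex.I,
    ((-c (z 0).re : ℝ) : ℂ) * Complex.I, 0] : Fin 3 → ℂ) i

theorem isSymplecticAt_couplingShear {c c' b : ℝ → ℝ} (hc : ∀ x, HasDerivAt c (c' x) x)
    (hc' : ContDiff ℝ ∞ c') (hb : ContDiff ℝ ∞ b) (z : Fin 3 → ℂ) :
    IsSymplecticAt (couplingShear c c' b) z := by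
  have hx : ∀ i : Fin 3, HasFDerivAt (fun z : Fin 3 → ℂ => (z i).re)
      (Complex.reCLM.comp (ContinuousLinearMap.proj (R := ℝ) (φ := fun _ => ℂ) i)) z :=
    fun i => (Complex.reCLM.comp
      (ContinuousLinearMap.proj (R := ℝ) (φ := fun _ : Fin 3 => ℂ) i)).hasFDerivAt
  have cx : ∀ i : Fin 3, ContDiff ℝ ∞ (fun z : Fin 3 → ℂ => (z i).re) :=
    fun i => (Complex.reCLM.comp
      (ContinuousLinearMap.proj (R := ℝ) (φ := fun _ : Fin 3 => ℂ) i)).contDiff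
  have hcd := hc (z 0).re
  have hcd' := ((hc'.differentiable (by simp)) (z 0).re).hasDerivAt
  have hbd := ((hb.differentiable (by simp)) (z 0).re).hasDerivAt
  have d0 := ((hbd.comp_hasFDerivAt z (hx 0)).sub
    ((hcd'.comp_hasFDerivAt z (hx 0)).mul (hx 1)))
  have d1 := (hcd.comp_hasFDerivAt z (hx 0)).neg
  have e0 := ((Complex.ofRealCLM.hasFDerivAt).comp z d0).mul_const Complex.I
  have e1 := ((Complex.ofRealCLM.hasFDerivAt).comp z d1).mul_const Complex.I
  have of : ∀ {F : (Fin 3 → ℂ) → ℝ}, ContDiff ℝ ∞ F →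
      ContDiffAt ℝ ∞ (fun z => ((F z : ℝ) : ℂ) * Complex.I) z := fun hF =>
    ((Complex.ofRealCLM.contDiff.comp hF).mul contDiff_const).contDiffAt
  refine isSymplecticAt_id_add
    (of ((hb.comp (cx 0)).sub ((hc'.comp (cx 0)).mul (cx 1))))
    (of ((contDiff_of_hasDerivAt hc hc').comp (cx 0)).neg)
    contDiffAt_const e0 e1 (hasFDerivAt_const _ _) fun v w => ?_
  simp [stdSymplectic, Fin.sum_univ_three]
  ring

/-- The time-one Hamiltonian flow of `κ(x₁) y₂`: a translation of `x₂` by `κ(x₁)`, compensated by a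
motion of `y₁` along the level sets of `x₁`. -/
noncomputable def separatingShear (κ : ℝ → ℝ) (z : Fin 3 → ℂ) : Fin 3 → ℂ := fun i =>
  z i + (![0, ((-(deriv κ (z 1).re * (z 2).im) : ℝ) : ℂ) * Complex.I,
    ((κ (z 1).re : ℝ) : ℂ)] : Fin 3 → ℂ) i

theorem isSymplecticAt_separatingShear {κ : ℝ → ℝ} (hκ : ContDiff ℝ ∞ κ) (z : Fin 3 → ℂ) :
    IsSymplecticAt (separatingShear κ) z := by
  have hx : HasFDerivAt (fun z : Fin 3 → ℂ => (z 1).re)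
      (Complex.reCLM.comp (ContinuousLinearMap.proj (R := ℝ) (φ := fun _ => ℂ) 1)) z :=
    (Complex.reCLM.comp
      (ContinuousLinearMap.proj (R := ℝ) (φ := fun _ : Fin 3 => ℂ) 1)).hasFDerivAt
  have hy : HasFDerivAt (fun z : Fin 3 → ℂ => (z 2).im)
      (Complex.imCLM.comp (ContinuousLinearMap.proj (R := ℝ) (φ := fun _ => ℂ) 2)) z :=
    (Complex.imCLM.comp
      (ContinuousLinearMap.proj (R := ℝ) (φ := fun _ : Fin 3 => ℂ) 2)).hasFDerivAt
  have cx : ContDiff ℝ ∞ (fun z : Fin 3 → ℂ => (z 1).re) :=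
    (Complex.reCLM.comp
      (ContinuousLinearMap.proj (R := ℝ) (φ := fun _ : Fin 3 => ℂ) 1)).contDiff
  have cy : ContDiff ℝ ∞ (fun z : Fin 3 → ℂ => (z 2).im) :=
    (Complex.imCLM.comp
      (ContinuousLinearMap.proj (R := ℝ) (φ := fun _ : Fin 3 => ℂ) 2)).contDiff
  have hκ' : ContDiff ℝ ∞ (deriv κ) := (contDiff_infty_iff_deriv.1 hκ).2
  have hd := ((hκ.differentiable (by simp)) (z 1).re).hasDerivAt
  have hd' := ((hκ'.differentiable (by simp)) (z 1).re).hasDerivAt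
  have e1 := ((Complex.ofRealCLM.hasFDerivAt).comp z
    ((hd'.comp_hasFDerivAt z hx).mul hy).neg).mul_const Complex.I
  have e2 := (Complex.ofRealCLM.hasFDerivAt).comp z (hd.comp_hasFDerivAt z hx)
  refine isSymplecticAt_id_add contDiffAt_const
    ((Complex.ofRealCLM.contDiff.comp ((hκ'.comp cx).mul cy).neg).mul contDiff_const).contDiffAt
    (Complex.ofRealCLM.contDiff.comp (hκ.comp cx)).contDiffAt
    (hasFDerivAt_const _ _) e1 e2 fun v w => ?_
  simp [stdSymplectic, Fin.sum_univ_three]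
  ring

/-! ### The parameters and the profile functions -/

/-- The parameters of the multiple fold. The ellipsoid is `E(a, 1, S)`, and `lam` is the area of the
fibre at which it is cut. A ribbon of width `η` carries the part of the base beyond the cut; the
angles of the fibre lie in `(m, 1 - m)`; the last factor lies in the disc of radius `R`. -/
structure FoldData where
  /-- the area of the base disc -/
  a : ℝ
  /-- the area of the fibre at the cut -/
  lam : ℝ
  /-- the width of the ribbon -/
  η : ℝ
  /-- the margin for the angles of the fibre -/
  m : ℝ
  /-- a bound for the last coordinate -/
  R : ℝ
  one_lt_a : 1 < a
  half_le_lam : 1 / 2 ≤ lam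
  lam_mul_le : lam * (a + 1) ≤ a
  η_pos : 0 < η
  η_le : η ≤ 1
  m_pos : 0 < m
  m_lt : m < 1 / 2
  m_le : m ≤ η
  R_pos : 0 < R

namespace FoldData

variable (D : FoldData)

/-- The width of the smoothing intervals. -/
noncomputable def δ : ℝ := D.η / 4

/-- The radius at which the two linear pieces of the bound meet, in the coordinate `u`. -/
noncomputable def us : ℝ := D.a * (2 * D.lam - 1) / (D.a - 1)

/-- The profile of the base: its inverse takes the coordinate `X` of the strip to `u`. It has slope
`1`, then `a`, up to the cut at `u ≈ lam`, and slope `η` on the ribbon. -/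
noncomputable def profile (u : ℝ) : ℝ :=
  u + (D.a - 1) * smoothRamp D.δ (u - D.us) - (D.a - D.η) * smoothRamp D.δ (u - D.lam - D.δ)

/-- The derivative of `profile`. -/
noncomputable def profileDeriv (u : ℝ) : ℝ :=
  1 + (D.a - 1) * smoothStep D.δ (u - D.us) - (D.a - D.η) * smoothStep D.δ (u - D.lam - D.δ)

/-- The final radial coordinate `t = π |z|²` as a function of `u`. -/
noncomputable def radius (u : ℝ) : ℝ := 2 * u + (D.a - 1) * smoothRamp D.δ (u - D.us)

/-- The derivative of `radius`; it is also the length of the circle with coordinate `u`. -/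
noncomputable def radiusDeriv (u : ℝ) : ℝ := 2 + (D.a - 1) * smoothStep D.δ (u - D.us)

/-- An upper bound for the area of the fibres at the position `x` of the ribbon. -/
noncomputable def fibreBound (x : ℝ) : ℝ := D.lam + D.δ - D.η / D.a * x

theorem δ_pos : 0 < D.δ := by have := D.η_pos; unfold δ; positivity

theorem us_mul : (D.a - 1) * D.us = D.a * (2 * D.lam - 1) := by
  have : D.a - 1 ≠ 0 := (sub_pos.2 D.one_lt_a).ne'
  unfold us
  field_simp

theorem us_nonneg : 0 ≤ D.us := by
  have h1 := D.one_lt_a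
  have h2 := D.half_le_lam
  unfold us
  exact div_nonneg (mul_nonneg (by linarith) (by linarith)) (by linarith)

theorem us_le_lam : D.us ≤ D.lam := by
  have h1 := D.one_lt_a
  have h2 := D.lam_mul_le
  unfold us
  rw [div_le_iff₀ (by linarith)]
  nlinarith

theorem hasDerivAt_ramp_sub (b x : ℝ) :
    HasDerivAt (fun u => smoothRamp D.δ (u - b)) (smoothStep D.δ (x - b)) x := by
  exact (hasDerivAt_smoothRamp D.δ (x - b)).comp_sub_const x b

theorem hasDerivAt_profile (u : ℝ) : HasDerivAt D.profile (D.profileDeriv u) u := by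
  have h := ((hasDerivAt_id u).add ((D.hasDerivAt_ramp_sub D.us u).const_mul (D.a - 1))).sub
    ((D.hasDerivAt_ramp_sub (D.lam + D.δ) u).const_mul (D.a - D.η))
  simp only [← sub_sub] at h
  exact h

theorem hasDerivAt_radius (u : ℝ) : HasDerivAt D.radius (D.radiusDeriv u) u := by
  have h := ((hasDerivAt_id u).const_mul 2).add
    ((D.hasDerivAt_ramp_sub D.us u).const_mul (D.a - 1))
  simp only [mul_one] at h
  exact h

theorem contDiff_step_sub (b : ℝ) : ContDiff ℝ ∞ fun u => smoothStep D.δ (u - b) :=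
  (contDiff_smoothStep D.δ).comp (contDiff_id.sub contDiff_const)

theorem contDiff_profileDeriv : ContDiff ℝ ∞ D.profileDeriv := by
  have h := (contDiff_const (c := (1 : ℝ))).add
    ((contDiff_const (c := D.a - 1)).mul (D.contDiff_step_sub D.us)) |>.sub
    ((contDiff_const (c := D.a - D.η)).mul (D.contDiff_step_sub (D.lam + D.δ)))
  simp only [← sub_sub] at h
  exact h

theorem contDiff_radiusDeriv : ContDiff ℝ ∞ D.radiusDeriv :=
  contDiff_const.add (contDiff_const.mul (D.contDiff_step_sub D.us))

theorem η_le_profileDeriv (u : ℝ) : D.η ≤ D.profileDeriv u := by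
  have h1 := D.one_lt_a
  have h2 := D.η_le
  have hδ := D.δ_pos
  have hs := smoothStep_nonneg D.δ (u - D.us)
  unfold profileDeriv
  rcases le_total u (D.lam + D.δ) with h | h
  · rw [smoothStep_of_nonpos hδ (show u - D.lam - D.δ ≤ 0 by linarith)]
    nlinarith
  · have := D.us_le_lam
    rw [smoothStep_of_le hδ (show D.δ ≤ u - D.us by linarith)]
    have := smoothStep_le_one D.δ (u - D.lam - D.δ)
    nlinarith

theorem profileDeriv_eq {u : ℝ} (hu : D.lam + 2 * D.δ ≤ u) : D.profileDeriv u = D.η := by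
  have hδ := D.δ_pos
  have := D.us_le_lam
  unfold profileDeriv
  rw [smoothStep_of_le hδ (show D.δ ≤ u - D.us by linarith),
    smoothStep_of_le hδ (show D.δ ≤ u - D.lam - D.δ by linarith)]
  ring

theorem profileDeriv_add_one_le (u : ℝ) : D.profileDeriv u + 1 ≤ D.radiusDeriv u := by
  have h1 := D.one_lt_a
  have h2 := D.η_le
  have := smoothStep_nonneg D.δ (u - D.lam - D.δ)
  unfold profileDeriv radiusDeriv
  nlinarith

theorem two_le_radiusDeriv (u : ℝ) : 2 ≤ D.radiusDeriv u := by
  have h1 := D.one_lt_a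
  have := smoothStep_nonneg D.δ (u - D.us)
  unfold radiusDeriv
  nlinarith

theorem strictMono_radius : StrictMono D.radius :=
  strictMono_of_hasDerivAt_pos D.hasDerivAt_radius
    fun u => lt_of_lt_of_le two_pos (D.two_le_radiusDeriv u)

theorem radius_zero : D.radius 0 = 0 := by
  have := D.us_nonneg
  rw [radius, smoothRamp_of_nonpos D.δ_pos (show 0 - D.us ≤ 0 by linarith)]
  ring

theorem profile_zero : D.profile 0 = 0 := by
  have h1 := D.us_nonneg
  have h2 := D.δ_pos
  have h3 := D.half_le_lam
  rw [profile, smoothRamp_of_nonpos D.δ_pos (show 0 - D.us ≤ 0 by linarith),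
    smoothRamp_of_nonpos D.δ_pos (show 0 - D.lam - D.δ ≤ 0 by linarith)]
  ring

theorem radius_le (u : ℝ) :
    D.radius u ≤ max (2 * u) ((D.a + 1) * u - D.a * (2 * D.lam - 1)) := by
  have h1 := D.one_lt_a
  have h2 := smoothRamp_le_max D.δ_pos (u - D.us)
  have h3 := D.us_mul
  unfold radius
  rcases max_cases (u - D.us) 0 with ⟨h, _⟩ | ⟨h, _⟩
  · rw [h] at h2
    refine le_max_of_le_right ?_
    nlinarith
  · rw [h] at h2
    refine le_max_of_le_left ?_
    nlinarith

/-- Before the cut the profile dominates the bound that keeps `(u, w)` below `u + w = 2 lam`. -/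
theorem le_profile {u : ℝ} (hu : u ≤ D.lam + D.δ) :
    D.a * (u + 1 - 2 * D.lam) - D.a * D.δ ≤ D.profile u := by
  have h1 := D.one_lt_a
  have h2 := sub_le_smoothRamp D.δ_pos (u - D.us)
  have h3 := D.us_mul
  have h4 := D.δ_pos
  unfold profile
  rw [smoothRamp_of_nonpos D.δ_pos (show u - D.lam - D.δ ≤ 0 by linarith)]
  nlinarith

/-- Beyond the cut the ribbon has used up the area `a (1 - lam)`. -/
theorem le_profile_of_le {u : ℝ} (hu : D.lam + D.δ ≤ u) :
    D.a * (1 - D.lam) + D.η * (u - D.lam - 2 * D.δ) ≤ D.profile u := by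
  have h1 := D.one_lt_a
  have h2 := sub_le_smoothRamp D.δ_pos (u - D.us)
  have h3 := D.us_mul
  have h4 := D.δ_pos
  have h5 : smoothRamp D.δ (u - D.lam - D.δ) ≤ u - D.lam - D.δ :=
    smoothRamp_le_self (by linarith)
  have h6 := D.η_le
  have h7 := D.η_pos
  unfold profile
  nlinarith [mul_le_mul_of_nonneg_left h2 (show 0 ≤ D.a - 1 by linarith),
    mul_le_mul_of_nonneg_left h5 (show 0 ≤ D.a - D.η by linarith)]

/-- The profile as a homeomorphism of the line. -/
noncomputable def profileHomeo : ℝ ≃ₜ ℝ :=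
  homeomorphOfDeriv D.profile D.profileDeriv D.η D.η_pos D.hasDerivAt_profile D.η_le_profileDeriv

/-! ### The switch between the two fibres -/

/-- A smooth `2`-periodic function which is `0` on `[m / 2, 1 - m / 2]` and `1` on
`[1 + m / 2, 2 - m / 2]`. -/
noncomputable def switch (y : ℝ) : ℝ :=
  Real.smoothTransition (1 / 2 - Real.sin (Real.pi * y) / Real.sin (Real.pi * (D.m / 2)))

theorem contDiff_switch : ContDiff ℝ ∞ D.switch :=
  Real.smoothTransition.contDiff.comp (contDiff_const.sub
    ((Real.contDiff_sin.comp (contDiff_const.mul contDiff_id)).div_const _))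

theorem switch_nonneg (y : ℝ) : 0 ≤ D.switch y := Real.smoothTransition.nonneg _

theorem switch_le_one (y : ℝ) : D.switch y ≤ 1 := Real.smoothTransition.le_one _

theorem switch_sub_intCast {y : ℝ} (h1 : D.m / 2 ≤ y) (h2 : y ≤ 1 - D.m / 2) (k : ℤ) :
    D.switch (y - k) = if Even k then 0 else 1 := by
  have hpi := Real.pi_pos
  have hm := D.m_pos
  have hm' := D.m_lt
  have hs : 0 < Real.sin (Real.pi * (D.m / 2)) :=
    Real.sin_pos_of_pos_of_lt_pi (by positivity) (by nlinarith)
  have hle : Real.sin (Real.pi * (D.m / 2)) ≤ Real.sin (Real.pi * y) := by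
    rcases le_total y (1 / 2) with h | h
    · exact Real.sin_le_sin_of_le_of_le_pi_div_two (by nlinarith) (by nlinarith) (by nlinarith)
    · rw [← Real.sin_pi_sub (Real.pi * y)]
      exact Real.sin_le_sin_of_le_of_le_pi_div_two (by nlinarith) (by nlinarith) (by nlinarith)
  have hq : 1 ≤ Real.sin (Real.pi * y) / Real.sin (Real.pi * (D.m / 2)) := (one_le_div hs).2 hle
  have e : Real.pi * (y - k) = Real.pi * y - k * Real.pi := by ring
  unfold switch
  rw [e, Real.sin_sub_int_mul_pi]
  split_ifs with hk
  · rw [hk.neg_one_zpow, one_mul]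
    exact Real.smoothTransition.zero_of_nonpos (by linarith)
  · rw [(Int.not_even_iff_odd.1 hk).neg_one_zpow, neg_one_mul, neg_div]
    exact Real.smoothTransition.one_of_one_le (by linarith)

/-- The translation of the last factor at stage `k`. On the fibres of area at most `lam`, and on the
complementary annuli, it is one of two consecutive multiples of `3 R`; the roles of the two are
interchanged at every stage. -/
noncomputable def shift (k : ℤ) (w : ℝ) : ℝ :=
  3 * D.R * (k + if Even k then smoothStep D.δ (w - (D.lam + D.δ))
    else 1 - smoothStep D.δ (w - (D.lam + D.δ)))

theorem contDiff_shift (k : ℤ) : ContDiff ℝ ∞ (D.shift k) := by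
  unfold shift
  split_ifs
  · exact contDiff_const.mul (contDiff_const.add (D.contDiff_step_sub _))
  · exact contDiff_const.mul (contDiff_const.add (contDiff_const.sub (D.contDiff_step_sub _)))

theorem shift_mem (k : ℤ) (w : ℝ) :
    3 * D.R * k ≤ D.shift k w ∧ D.shift k w ≤ 3 * D.R * (k + 1) := by
  have hR := D.R_pos
  have h1 := smoothStep_nonneg D.δ (w - (D.lam + D.δ))
  have h2 := smoothStep_le_one D.δ (w - (D.lam + D.δ))
  unfold shift
  constructor <;> refine mul_le_mul_of_nonneg_left ?_ (by positivity) <;> split_ifs <;> linarith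

/-- The translations of two consecutive stages agree on the fibres that occur where the stages
meet. -/
theorem shift_sub_one_eq {k : ℤ} {w : ℝ}
    (h : if Even k then w < D.lam + D.δ else D.lam + 2 * D.δ < w) :
    D.shift (k - 1) w = D.shift k w := by
  have hδ := D.δ_pos
  unfold shift
  by_cases hk : Even k
  · have hk' : ¬ Even (k - 1) := by rw [Int.even_sub_one]; simpa using hk
    rw [if_pos hk] at h
    rw [if_pos hk, if_neg hk', smoothStep_of_nonpos hδ (by linarith)]
    push_cast
    ring
  · have hk' : Even (k - 1) := by rw [Int.even_sub_one]; exact hk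
    rw [if_neg hk] at h
    rw [if_neg hk, if_pos hk', smoothStep_of_le hδ (by linarith)]
    push_cast
    ring

/-! ### The multiple fold -/

/-- The coordinate `u` of a point of the strip before it is lifted. -/
noncomputable def height (z : ℂ) : ℝ := D.profileHomeo.symm z.re

/-- The position of a point of the strip along the ribbon. -/
noncomputable def position (z : ℂ) : ℝ :=
  smoothRamp D.δ (D.height z - (D.lam + 2 * D.δ)) - z.im * D.profileDeriv (D.height z)

/-- The strip, narrowed to a ribbon beyond the cut and turned by a right angle there. -/
noncomputable def ribbon (z : ℂ) : ℂ :=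
  ((D.position z : ℝ) : ℂ) + ((D.height z : ℝ) : ℂ) * Complex.I

/-- The displacement of the ribbon, as a function of its position, before the fibre is taken into
account: the ribbon moves from `u ≈ lam` to the bottom of the region that the lift sweeps out. -/
noncomputable def descent (x : ℝ) : ℝ :=
  smoothStep (D.m / 2) x * (D.fibreBound x - (D.lam + 2 * D.δ) - x)

/-- The lift: the fibre turns once by a full angle while the position increases by `1`, and the
ribbon is displaced accordingly. -/
noncomputable def lift : (Fin 3 → ℂ) → (Fin 3 → ℂ) :=
  couplingShear (smoothRamp (D.m / 2)) (smoothStep (D.m / 2)) D.descent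

/-- The map of the fibre that moves the disc of area `lam` off itself as the angle passes an
integer, and back at the next one. -/
noncomputable def unroll (z : ℂ) : ℂ :=
  ((z.re + (D.lam + 2 * D.δ) * D.switch z.im : ℝ) : ℂ) + ((z.im : ℝ) : ℂ) * Complex.I

/-- The lifted ribbon, with values in the universal covers of the punctured planes. -/
noncomputable def lifted (z : Fin 3 → ℂ) : Fin 3 → ℂ := fun i =>
  (![fun x => x, D.unroll, fun x => x] : Fin 3 → ℂ → ℂ) i
    (D.lift (fun j => (![D.ribbon, fun x => x, fun x => x] : Fin 3 → ℂ → ℂ) j (z j)) i)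

/-- The immersion of the base into the plane: the position becomes an angle, taken modulo the length
`radiusDeriv u` of the circle. -/
noncomputable def wrap (z : ℂ) : ℂ :=
  fromPolar (((D.radius z.im : ℝ) : ℂ) + ((-z.re / D.radiusDeriv z.im : ℝ) : ℂ) * Complex.I)

/-- The fold near the points of stage `k`. -/
noncomputable def stageFold (k : ℤ) (z : Fin 3 → ℂ) : Fin 3 → ℂ := fun i =>
  (![D.wrap, fromPolar, fun x => x] : Fin 3 → ℂ → ℂ) i (separatingShear (D.shift k) (D.lifted z) i)

/-- The stage of a point is the integral part of its position, but the whole part of the base before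
the ribbon is one stage. -/
noncomputable def stage (z : ℂ) : ℤ := max ⌊D.position z⌋ (-1)

/-- The multiple fold. -/
noncomputable def fold (z : Fin 3 → ℂ) : Fin 3 → ℂ := D.stageFold (D.stage (z 0)) z

/-- The domain of the fold, in the coordinates of the half-strip for the first two factors. -/
def domain : Set (Fin 3 → ℂ) :=
  {z | 0 < (z 0).re ∧ 0 < (z 0).im ∧ (z 0).im < 1 ∧ 0 < (z 1).re ∧ D.m < (z 1).im ∧
    (z 1).im < 1 - D.m ∧ (z 0).re / D.a + (z 1).re < 1 + D.δ ∧ ‖z 2‖ < D.R}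

/-- The final radial coordinate of the base, before it is turned into an area. -/
noncomputable def level (z : Fin 3 → ℂ) : ℝ :=
  D.height (z 0) + D.descent (D.position (z 0))
    - smoothStep (D.m / 2) (D.position (z 0)) * (z 1).re

/-- The angle of the fibre after the lift. -/
noncomputable def angle (z : Fin 3 → ℂ) : ℝ :=
  (z 1).im - smoothRamp (D.m / 2) (D.position (z 0))

/-- The area coordinate of the fibre after the lift. -/
noncomputable def fibreArea (z : Fin 3 → ℂ) : ℝ :=
  (z 1).re + (D.lam + 2 * D.δ) * D.switch (D.angle z)

theorem lifted_zero (z : Fin 3 → ℂ) :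
    D.lifted z 0 = ((D.position (z 0) : ℝ) : ℂ) + ((D.level z : ℝ) : ℂ) * Complex.I := by
  simp [lifted, lift, couplingShear, ribbon, level]
  ring

theorem lifted_one (z : Fin 3 → ℂ) :
    D.lifted z 1 = ((D.fibreArea z : ℝ) : ℂ) + ((D.angle z : ℝ) : ℂ) * Complex.I := by
  have h : D.lift (fun j => (![D.ribbon, fun x => x, fun x => x] : Fin 3 → ℂ → ℂ) j (z j)) 1
      = (((z 1).re : ℝ) : ℂ) + ((D.angle z : ℝ) : ℂ) * Complex.I := by
    apply Complex.ext <;> simp [lift, couplingShear, ribbon, angle]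
    ring
  show D.unroll (D.lift _ 1) = _
  rw [h, unroll, re_ofReal_add_ofReal_mul_I, im_ofReal_add_ofReal_mul_I]
  rfl

theorem lifted_two (z : Fin 3 → ℂ) : D.lifted z 2 = z 2 := by
  simp [lifted, lift, couplingShear]

theorem stageFold_zero (k : ℤ) (z : Fin 3 → ℂ) :
    D.stageFold k z 0 = fromPolar (((D.radius (D.level z) : ℝ) : ℂ)
      + ((-D.position (z 0) / D.radiusDeriv (D.level z) : ℝ) : ℂ) * Complex.I) := by
  show D.wrap (separatingShear (D.shift k) (D.lifted z) 0) = _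
  have h : separatingShear (D.shift k) (D.lifted z) 0 = D.lifted z 0 := by
    simp [separatingShear]
  rw [h, lifted_zero, wrap, re_ofReal_add_ofReal_mul_I, im_ofReal_add_ofReal_mul_I]

theorem stageFold_one (k : ℤ) (z : Fin 3 → ℂ) :
    D.stageFold k z 1 = fromPolar (((D.fibreArea z : ℝ) : ℂ)
      + ((D.angle z - deriv (D.shift k) (D.fibreArea z) * (z 2).im : ℝ) : ℂ) * Complex.I) := by
  show fromPolar (separatingShear (D.shift k) (D.lifted z) 1) = _
  congr 1
  simp only [separatingShear, lifted_one, lifted_two, re_ofReal_add_ofReal_mul_I]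
  simp
  ring

theorem stageFold_two (k : ℤ) (z : Fin 3 → ℂ) :
    D.stageFold k z 2 = z 2 + ((D.shift k (D.fibreArea z) : ℝ) : ℂ) := by
  show separatingShear (D.shift k) (D.lifted z) 2 = _
  simp [separatingShear, lifted_one, lifted_two]

theorem isAreaPreservingAt_ribbon (z : ℂ) : IsAreaPreservingAt D.ribbon z :=
  isAreaPreservingAt_bend (e := D.profileHomeo) D.hasDerivAt_profile D.contDiff_profileDeriv
    (fun u => (D.η_pos.trans_le (D.η_le_profileDeriv u)).ne')
    ((contDiff_smoothRamp D.δ).comp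
      (contDiff_id.sub (contDiff_const (c := D.lam + 2 * D.δ)))) z

theorem contDiff_descent : ContDiff ℝ ∞ D.descent :=
  (contDiff_smoothStep _).mul (((contDiff_const.sub (contDiff_const.mul contDiff_id)).sub
    contDiff_const).sub contDiff_id)

theorem isSymplecticAt_lifted (z : Fin 3 → ℂ) : IsSymplecticAt D.lifted z := by
  refine (isSymplecticAt_pi (g := ![fun x => x, D.unroll, fun x => x]) fun i => ?_).comp
    ((isSymplecticAt_couplingShear (hasDerivAt_smoothRamp _) (contDiff_smoothStep _)
      D.contDiff_descent _).comp
      (isSymplecticAt_pi (g := ![D.ribbon, fun x => x, fun x => x]) fun i => ?_))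
  · fin_cases i
    · exact isAreaPreservingAt_id _
    · exact isAreaPreservingAt_shear (contDiff_const.mul D.contDiff_switch) _
    · exact isAreaPreservingAt_id _
  · fin_cases i
    · exact D.isAreaPreservingAt_ribbon _
    · exact isAreaPreservingAt_id _
    · exact isAreaPreservingAt_id _

theorem isAreaPreservingAt_wrap {z : ℂ} (hz : 0 < z.im) : IsAreaPreservingAt D.wrap z := by
  refine (isAreaPreservingAt_fromPolar ?_).comp (isAreaPreservingAt_stretch D.hasDerivAt_radius
    D.contDiff_radiusDeriv (fun u => (two_pos.trans_le (D.two_le_radiusDeriv u)).ne') z)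
  rw [re_ofReal_add_ofReal_mul_I, ← D.radius_zero]
  exact D.strictMono_radius hz

theorem isSymplecticAt_stageFold (k : ℤ) {z : Fin 3 → ℂ} (h0 : 0 < D.level z)
    (h1 : 0 < D.fibreArea z) : IsSymplecticAt (D.stageFold k) z := by
  refine (isSymplecticAt_pi (g := ![D.wrap, fromPolar, fun x => x]) fun i => ?_).comp
    ((isSymplecticAt_separatingShear (D.contDiff_shift k) _).comp (D.isSymplecticAt_lifted z))
  fin_cases i
  · refine D.isAreaPreservingAt_wrap ?_
    simpa [separatingShear, lifted_zero] using h0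
  · refine isAreaPreservingAt_fromPolar ?_
    simpa [separatingShear, lifted_one] using h1
  · exact isAreaPreservingAt_id _

theorem profile_height (z : ℂ) : D.profile (D.height z) = z.re :=
  D.profileHomeo.apply_symm_apply z.re

theorem continuous_position : Continuous D.position := by
  have h := continuous_iff_continuousAt.2 fun z => (D.isAreaPreservingAt_ribbon z).1.continuousAt
  have h2 : D.position = fun z => (D.ribbon z).re :=
    funext fun z => (re_ofReal_add_ofReal_mul_I _ _).symm
  rw [h2]
  exact Complex.continuous_re.comp h

theorem continuous_fibreArea : Continuous D.fibreArea := by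
  have h := continuous_iff_continuousAt.2 fun z => (D.isSymplecticAt_lifted z).1.continuousAt
  have h2 : D.fibreArea = fun z => (D.lifted z 1).re :=
    funext fun z => by rw [lifted_one, re_ofReal_add_ofReal_mul_I]
  rw [h2]
  exact Complex.continuous_re.comp ((continuous_apply 1).comp h)

section Bounds

variable {D} {z : Fin 3 → ℂ} (hz : z ∈ D.domain)

include hz

theorem height_pos : 0 < D.height (z 0) := by
  have h1 : D.profile 0 < D.profile (D.height (z 0)) := by
    rw [D.profile_height, D.profile_zero]
    exact hz.1
  exact (strictMono_of_hasDerivAt_pos D.hasDerivAt_profile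
    fun u => D.η_pos.trans_le (D.η_le_profileDeriv u)).lt_iff_lt.1 h1

/-- The points at nonnegative positions lie on the ribbon, where the profile has slope `η`. -/
theorem le_height (hx : 0 ≤ D.position (z 0)) :
    D.lam + 2 * D.δ + D.position (z 0) + (z 0).im * D.η ≤ D.height (z 0) := by
  have hη := D.η_pos
  have hδ := D.δ_pos
  have h1 : 0 < (z 0).im * D.profileDeriv (D.height (z 0)) :=
    mul_pos hz.2.1 (hη.trans_le (D.η_le_profileDeriv _))
  have h2 : D.position (z 0) + (z 0).im * D.profileDeriv (D.height (z 0))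
      = smoothRamp D.δ (D.height (z 0) - (D.lam + 2 * D.δ)) := by
    unfold position; ring
  have h3 : D.lam + 2 * D.δ ≤ D.height (z 0) := by
    by_contra hcon
    push Not at hcon
    rw [smoothRamp_of_nonpos hδ (by linarith)] at h2
    linarith
  have h4 : smoothRamp D.δ (D.height (z 0) - (D.lam + 2 * D.δ))
      ≤ D.height (z 0) - (D.lam + 2 * D.δ) := smoothRamp_le_self (by linarith)
  rw [D.profileDeriv_eq h3] at h2
  linarith

omit hz in
theorem height_le (h : D.lam + 2 * D.δ ≤ D.height (z 0)) :
    D.height (z 0) ≤ D.lam + 3 * D.δ + D.position (z 0) + (z 0).im * D.η := by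
  have h1 := sub_le_smoothRamp D.δ_pos (D.height (z 0) - (D.lam + 2 * D.δ))
  have h2 : D.position (z 0) + (z 0).im * D.profileDeriv (D.height (z 0))
      = smoothRamp D.δ (D.height (z 0) - (D.lam + 2 * D.δ)) := by
    unfold position; ring
  rw [D.profileDeriv_eq h] at h2
  linarith

theorem area_lt_fibreBound (hx : 0 ≤ D.position (z 0)) :
    (z 1).re < D.fibreBound (D.position (z 0)) := by
  have ha := D.one_lt_a
  have hη := D.η_pos
  have hδ := D.δ_pos
  have h1 := le_height hz hx
  have h2 := mul_pos hz.2.1 hη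
  have h3 := D.le_profile_of_le (u := D.height (z 0)) (by linarith)
  rw [D.profile_height] at h3
  have h4 : D.η * D.position (z 0) ≤ D.η * (D.height (z 0) - D.lam - 2 * D.δ) :=
    mul_le_mul_of_nonneg_left (by linarith) hη.le
  have h5 : (D.a * (1 - D.lam) + D.η * D.position (z 0)) / D.a ≤ (z 0).re / D.a :=
    div_le_div_of_nonneg_right (by linarith) (by linarith)
  have h6 : (D.a * (1 - D.lam) + D.η * D.position (z 0)) / D.a
      = 1 - D.lam + D.η / D.a * D.position (z 0) := by
    have : D.a ≠ 0 := by linarith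
    field_simp
  have h7 := hz.2.2.2.2.2.2.1
  unfold fibreBound
  linarith

omit hz in
theorem fibreBound_le {x : ℝ} (hx : 0 ≤ x) : D.fibreBound x ≤ D.lam + D.δ := by
  have := D.one_lt_a
  have := D.η_pos
  have : 0 ≤ D.η / D.a * x := by positivity
  unfold fibreBound
  linarith

theorem level_pos : 0 < D.level z := by
  have hm := half_pos D.m_pos
  rcases le_total (D.position (z 0)) 0 with h | h
  · have := height_pos hz
    simp only [level, descent, smoothStep_of_nonpos hm h]
    linarith
  · have h1 := le_height hz h
    have h2 := area_lt_fibreBound hz h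
    have h3 := smoothStep_nonneg (D.m / 2) (D.position (z 0))
    have h4 := smoothStep_le_one (D.m / 2) (D.position (z 0))
    have h5 := mul_pos hz.2.1 D.η_pos
    have h6 := D.half_le_lam
    have h7 := D.δ_pos
    unfold level descent
    nlinarith [mul_nonneg h3 (sub_nonneg.2 h2.le),
      mul_nonneg (sub_nonneg.2 h4) (show 0 ≤ D.lam + 2 * D.δ + D.position (z 0) by linarith)]

theorem fibreArea_pos : 0 < D.fibreArea z := by
  have := D.half_le_lam
  have := D.δ_pos
  have := mul_nonneg (show 0 ≤ D.lam + 2 * D.δ by linarith) (D.switch_nonneg (D.angle z))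
  have := hz.2.2.2.1
  unfold fibreArea
  linarith

omit hz in
theorem fibreArea_le : D.fibreArea z ≤ (z 1).re + (D.lam + 2 * D.δ) := by
  have := D.half_le_lam
  have := D.δ_pos
  have := mul_le_mul_of_nonneg_left (D.switch_le_one (D.angle z))
    (show 0 ≤ D.lam + 2 * D.δ by linarith)
  unfold fibreArea
  linarith

theorem fibreArea_eq (hx : D.position (z 0) ≤ D.m / 2) : D.fibreArea z = (z 1).re := by
  have hm := D.m_pos
  have h1 := smoothRamp_le_max (half_pos hm) (D.position (z 0))
  have h2 := smoothRamp_nonneg (half_pos hm) (D.position (z 0))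
  have h3 : max (D.position (z 0)) 0 ≤ D.m / 2 := max_le hx (by linarith)
  have h4 := hz.2.2.2.2.1
  have h5 := hz.2.2.2.2.2.1
  have h6 := D.switch_sub_intCast (y := D.angle z) (by unfold angle; linarith)
    (by unfold angle; linarith) 0
  simp only [Int.cast_zero, sub_zero, Even.zero, if_true] at h6
  simp [fibreArea, h6]

/-- The image of the fold lies close to the bound `u + w = 2 lam`. -/
theorem level_bounds :
    D.level z ≤ D.lam + 3 * D.η ∧ D.level z + D.fibreArea z ≤ 2 * (D.lam + 3 * D.η) := by
  have ha := D.one_lt_a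
  have hη := D.η_pos
  have hδ : D.δ = D.η / 4 := rfl
  have hm := D.m_pos
  have hmη := D.m_le
  have hY := hz.2.2.1
  have hq : (z 0).im * D.η < D.η := by nlinarith
  rcases le_total (D.position (z 0)) 0 with h | h
  · have hu : D.level z = D.height (z 0) := by
      simp only [level, descent, smoothStep_of_nonpos (half_pos hm) h]
      ring
    rw [hu, fibreArea_eq hz (by linarith)]
    have hw := hz.2.2.2.2.2.2.1
    have ha0 : (0 : ℝ) < D.a := by linarith
    rcases le_total (D.height (z 0)) (D.lam + D.δ) with h' | h'
    · have h1 := D.le_profile h'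
      rw [D.profile_height] at h1
      have h2 : D.height (z 0) + 1 - 2 * D.lam - D.δ ≤ (z 0).re / D.a := by
        rw [le_div_iff₀ ha0]; linarith
      constructor <;> linarith
    · have h1 := D.le_profile_of_le h'
      rw [D.profile_height] at h1
      have h2 : 1 - D.lam - D.δ ≤ (z 0).re / D.a := by
        rw [le_div_iff₀ ha0]
        have : -D.δ ≤ D.η * (D.height (z 0) - D.lam - 2 * D.δ) := by
          have := D.η_le
          nlinarith
        nlinarith
      have h3 : D.height (z 0) ≤ D.lam + 3 * D.δ + D.η := by
        rcases le_total (D.height (z 0)) (D.lam + 2 * D.δ) with h'' | h''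
        · linarith
        · linarith [height_le h'']
      constructor <;> linarith
  · have h1 := le_height hz h
    have h2 := area_lt_fibreBound hz h
    have h3 := smoothStep_nonneg (D.m / 2) (D.position (z 0))
    have h4 := smoothStep_le_one (D.m / 2) (D.position (z 0))
    have h5 := mul_pos hz.2.1 hη
    have h6 := height_le (D := D) (z := z) (by linarith)
    have h7 := D.half_le_lam
    have h8 := fibreBound_le (D := D) h
    have hw := hz.2.2.2.1
    rcases le_total (D.position (z 0)) (D.m / 2) with h' | h'
    · rw [fibreArea_eq hz h']
      have hu : D.level z ≤ D.lam + 2 * D.δ + D.m / 2 + D.η + D.δ := by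
        unfold level descent
        nlinarith [mul_nonneg h3 (show 0 ≤ D.lam + 2 * D.δ + D.position (z 0)
          - (D.fibreBound (D.position (z 0)) - (z 1).re) by linarith)]
      constructor <;> linarith
    · have hu : D.level z = D.height (z 0) + (D.fibreBound (D.position (z 0))
          - (D.lam + 2 * D.δ) - D.position (z 0)) - (z 1).re := by
        unfold level descent
        rw [smoothStep_of_le (half_pos hm) h']
        ring
      have := fibreArea_le (D := D) (z := z)
      constructor <;> linarith

/-- Far out on the ribbon the fibres have become so small that the bounds hold exactly. -/
theorem level_bounds_of_le (h : 2 * D.a ≤ D.position (z 0)) :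
    D.level z ≤ D.lam ∧ D.level z + D.fibreArea z ≤ 2 * D.lam := by
  have ha := D.one_lt_a
  have hη := D.η_pos
  have hδ : D.δ = D.η / 4 := rfl
  have hY := hz.2.2.1
  have hq : (z 0).im * D.η < D.η := by nlinarith
  have h0 : 0 ≤ D.position (z 0) := by linarith
  have h1 := le_height hz h0
  have h5 := mul_pos hz.2.1 hη
  have h6 := height_le (D := D) (z := z) (by linarith [D.δ_pos])
  have hu : D.level z = D.height (z 0) + (D.fibreBound (D.position (z 0))
      - (D.lam + 2 * D.δ) - D.position (z 0)) - (z 1).re := by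
    have := D.m_lt
    unfold level descent
    rw [smoothStep_of_le (half_pos D.m_pos) (by linarith)]
    ring
  have hb : D.fibreBound (D.position (z 0)) ≤ D.lam + D.δ - 2 * D.η := by
    have : 2 * D.η ≤ D.η / D.a * D.position (z 0) := by
      have : D.η / D.a * (2 * D.a) ≤ D.η / D.a * D.position (z 0) :=
        mul_le_mul_of_nonneg_left h (by positivity)
      have e : D.η / D.a * (2 * D.a) = 2 * D.η := by
        have : D.a ≠ 0 := by linarith
        field_simp
      linarith
    unfold fibreBound
    linarith
  have hw := hz.2.2.2.1
  have := fibreArea_le (D := D) (z := z)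
  constructor <;> linarith

end Bounds

end FoldData

namespace FoldData

variable {D : FoldData}

/-! ### Smoothness across the stages, injectivity -/

/-- At an integral position the fibre is either a disc of area at most `lam` or its translate, so
that the maps of the two stages which meet there agree nearby. -/
theorem eventually_stageFold_sub_one_eq {z : Fin 3 → ℂ} (hz : z ∈ D.domain) {k : ℤ}
    (hk : D.position (z 0) = k) (hk0 : 0 ≤ k) :
    ∀ᶠ y in 𝓝 z, D.stageFold (k - 1) y = D.stageFold k y := by
  have hδ := D.δ_pos
  have hm := D.m_pos
  have hlam := D.half_le_lam
  have hk0' : (0 : ℝ) ≤ k := by exact_mod_cast hk0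
  set W : Set ℝ := if Even k then Set.Iio (D.lam + D.δ) else Set.Ioi (D.lam + 2 * D.δ) with hW
  have hWo : IsOpen W := by
    rw [hW]; split_ifs
    exacts [isOpen_Iio, isOpen_Ioi]
  have hsh : Set.EqOn (D.shift (k - 1)) (D.shift k) W := by
    intro w hw
    refine shift_sub_one_eq D ?_
    rw [hW] at hw
    split_ifs with h <;> simpa [h] using hw
  have hwW : D.fibreArea z ∈ W := by
    have h1 := sub_le_smoothRamp (half_pos hm) (D.position (z 0))
    have h2 : smoothRamp (D.m / 2) (D.position (z 0)) ≤ D.position (z 0) :=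
      smoothRamp_le_self (by rw [hk]; exact hk0')
    have h4 := hz.2.2.2.2.1
    have h5 := hz.2.2.2.2.2.1
    have h6 := D.switch_sub_intCast (y := D.angle z + k) (by unfold angle; linarith)
      (by unfold angle; linarith) k
    rw [add_sub_cancel_right] at h6
    have h7 := area_lt_fibreBound hz (by rw [hk]; exact hk0')
    have h8 := fibreBound_le (D := D) (x := D.position (z 0)) (by rw [hk]; exact hk0')
    have h9 := hz.2.2.2.1
    rw [hW, fibreArea, h6]
    split_ifs
    · rw [Set.mem_Iio]; linarith
    · rw [Set.mem_Ioi]; linarith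
  filter_upwards [D.continuous_fibreArea.continuousAt.eventually_mem (hWo.mem_nhds hwW)] with y hy
  have e1 := hsh hy
  have e2 : deriv (D.shift (k - 1)) (D.fibreArea y) = deriv (D.shift k) (D.fibreArea y) :=
    (hsh.eventuallyEq_of_mem (hWo.mem_nhds hy)).deriv_eq
  funext i
  fin_cases i
  · show D.stageFold (k - 1) y 0 = D.stageFold k y 0
    rw [stageFold_zero, stageFold_zero]
  · show D.stageFold (k - 1) y 1 = D.stageFold k y 1
    rw [stageFold_one, stageFold_one, e2]
  · show D.stageFold (k - 1) y 2 = D.stageFold k y 2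
    rw [stageFold_two, stageFold_two, e1]

theorem stage_eq_neg_one {z : ℂ} (h : D.position z < 0) : D.stage z = -1 := by
  have : ⌊D.position z⌋ < 0 := Int.floor_lt.2 (by simpa using h)
  unfold stage
  omega

theorem stage_eq_floor {z : ℂ} (h : 0 ≤ D.position z) : D.stage z = ⌊D.position z⌋ := by
  have : 0 ≤ ⌊D.position z⌋ := Int.floor_nonneg.2 h
  unfold stage
  omega

theorem fold_eventuallyEq {z : Fin 3 → ℂ} (hz : z ∈ D.domain) :
    D.fold =ᶠ[𝓝 z] D.stageFold (D.stage (z 0)) := by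
  have hc : ContinuousAt (fun y : Fin 3 → ℂ => D.position (y 0)) z :=
    (D.continuous_position.comp (continuous_apply 0)).continuousAt
  rcases lt_or_ge (D.position (z 0)) 0 with h | h
  · filter_upwards [hc.eventually_lt_const h] with y hy
    rw [fold, stage_eq_neg_one h, stage_eq_neg_one hy]
  · rw [stage_eq_floor h]
    set k := ⌊D.position (z 0)⌋ with hk
    have hk0 : 0 ≤ k := Int.floor_nonneg.2 h
    have hk0' : (0 : ℝ) ≤ k := by exact_mod_cast hk0
    have h1 : (k : ℝ) ≤ D.position (z 0) := Int.floor_le _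
    have h2 : D.position (z 0) < k + 1 := Int.lt_floor_add_one _
    have stay : ∀ y : Fin 3 → ℂ, (k : ℝ) ≤ D.position (y 0) → D.position (y 0) < k + 1 →
        D.stage (y 0) = k := by
      intro y hy1 hy2
      rw [stage_eq_floor (hk0'.trans hy1)]
      exact Int.floor_eq_iff.2 ⟨hy1, hy2⟩
    rcases h1.eq_or_lt with h3 | h3
    · filter_upwards [eventually_stageFold_sub_one_eq hz h3.symm hk0, hc.eventually_lt_const h2,
        hc.eventually_const_lt (show (k : ℝ) - 1 < D.position (z 0) by linarith)] with y hy hy1 hy2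
      rcases le_or_gt (k : ℝ) (D.position (y 0)) with h4 | h4
      · rw [fold, stay y h4 hy1]
      · have h5 : ⌊D.position (y 0)⌋ = k - 1 :=
          Int.floor_eq_iff.2 ⟨by push_cast; linarith, by push_cast; linarith⟩
        have h6 : D.stage (y 0) = k - 1 := by
          unfold stage
          omega
        rw [fold, h6, hy]
    · filter_upwards [hc.eventually_const_lt h3, hc.eventually_lt_const h2] with y hy1 hy2
      rw [fold, stay y hy1.le hy2]

theorem isSymplecticAt_fold {z : Fin 3 → ℂ} (hz : z ∈ D.domain) : IsSymplecticAt D.fold z :=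
  (D.isSymplecticAt_stageFold _ (level_pos hz) (fibreArea_pos hz)).congr (fold_eventuallyEq hz)

theorem neg_one_le_stage (z : ℂ) : -1 ≤ D.stage z := le_max_right _ _

theorem position_lt_stage (z : ℂ) : D.position z < D.stage z + 1 := by
  have h1 := Int.lt_floor_add_one (D.position z)
  have h2 : ⌊D.position z⌋ ≤ D.stage z := le_max_left _ _
  have h3 : (⌊D.position z⌋ : ℝ) ≤ D.stage z := by exact_mod_cast h2
  linarith

theorem stage_le_position {z : ℂ} (h : 0 ≤ D.stage z) : (D.stage z : ℝ) ≤ D.position z := by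
  have h1 : D.stage z = ⌊D.position z⌋ := by
    unfold stage at h ⊢
    omega
  rw [h1]
  exact Int.floor_le _

/-- Where the fold maps two points to the same point, their stages differ by at most one: otherwise
their last coordinates are separated. -/
theorem stage_le_of_fold_eq {z y : Fin 3 → ℂ} (hz : z ∈ D.domain) (hy : y ∈ D.domain)
    (h : D.fold z = D.fold y) (hw : D.fibreArea z = D.fibreArea y) :
    D.stage (y 0) ≤ D.stage (z 0) + 1 := by
  by_contra hcon
  push Not at hcon
  have hR := D.R_pos
  have h2 := congrFun h 2
  rw [fold, fold, stageFold_two, stageFold_two, hw] at h2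
  have h3 := congrArg Complex.re h2
  simp only [Complex.add_re, Complex.ofReal_re] at h3
  have h4 := (D.shift_mem (D.stage (z 0)) (D.fibreArea y)).2
  have h5 := (D.shift_mem (D.stage (y 0)) (D.fibreArea y)).1
  have h6 : ((D.stage (z 0) : ℝ) + 2) ≤ D.stage (y 0) := by
    have : D.stage (z 0) + 2 ≤ D.stage (y 0) := by omega
    exact_mod_cast this
  have h7 := abs_le.1 ((Complex.abs_re_le_norm (z 2)).trans hz.2.2.2.2.2.2.2.le)
  have h8 := abs_le.1 ((Complex.abs_re_le_norm (y 2)).trans hy.2.2.2.2.2.2.2.le)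
  nlinarith

/-- Within two consecutive stages the ribbon advances by less than the length of each circle that it
meets. -/
theorem position_sub_lt_of_stage_le {z y : Fin 3 → ℂ} (hz : z ∈ D.domain)
    (hs : D.stage (y 0) ≤ D.stage (z 0) + 1) :
    D.position (y 0) - D.position (z 0) < D.radiusDeriv (D.level z) := by
  have h1 := position_lt_stage (D := D) (y 0)
  have hs' : (D.stage (y 0) : ℝ) ≤ D.stage (z 0) + 1 := by exact_mod_cast hs
  rcases lt_or_ge (D.stage (z 0)) 0 with h | h
  · have h2 : D.stage (z 0) = -1 := by
      have := neg_one_le_stage (D := D) (z 0)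
      omega
    have hpos : D.position (z 0) < 0 := by
      have := position_lt_stage (D := D) (z 0)
      rw [h2] at this
      push_cast at this
      linarith
    have hl : D.level z = D.height (z 0) := by
      simp only [level, descent, smoothStep_of_nonpos (half_pos D.m_pos) hpos.le]
      ring
    have h3 := D.profileDeriv_add_one_le (D.height (z 0))
    have h4 := smoothRamp_nonneg D.δ_pos (D.height (z 0) - (D.lam + 2 * D.δ))
    have h5 : (z 0).im * D.profileDeriv (D.height (z 0)) < D.profileDeriv (D.height (z 0)) := by
      have := D.η_pos.trans_le (D.η_le_profileDeriv (D.height (z 0)))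
      nlinarith [hz.2.2.1]
    rw [h2] at hs'
    push_cast at hs'
    rw [hl]
    have h6 : -D.position (z 0) < D.profileDeriv (D.height (z 0)) := by
      unfold position
      linarith
    linarith
  · have h2 := stage_le_position h
    have h3 := D.two_le_radiusDeriv (D.level z)
    linarith

theorem radius_level_pos {z : Fin 3 → ℂ} (hz : z ∈ D.domain) : 0 < D.radius (D.level z) := by
  rw [← D.radius_zero]
  exact D.strictMono_radius (level_pos hz)

theorem injOn_fold : Set.InjOn D.fold D.domain := by
  intro z hz y hy h
  -- the area coordinates and the angles of the first two factors
  have e0 := congrFun h 0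
  have e1 := congrFun h 1
  have e2 := congrFun h 2
  rw [fold, fold, stageFold_zero, stageFold_zero] at e0
  rw [fold, fold, stageFold_one, stageFold_one] at e1
  rw [fold, fold, stageFold_two, stageFold_two] at e2
  obtain ⟨hr, n, hn⟩ := fromPolar_eq
    (by rw [re_ofReal_add_ofReal_mul_I]; exact radius_level_pos hz)
    (by rw [re_ofReal_add_ofReal_mul_I]; exact radius_level_pos hy) e0
  obtain ⟨hw, l, hl⟩ := fromPolar_eq
    (by rw [re_ofReal_add_ofReal_mul_I]; exact fibreArea_pos hz)
    (by rw [re_ofReal_add_ofReal_mul_I]; exact fibreArea_pos hy) e1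
  rw [re_ofReal_add_ofReal_mul_I, re_ofReal_add_ofReal_mul_I] at hr hw
  rw [im_ofReal_add_ofReal_mul_I, im_ofReal_add_ofReal_mul_I] at hn hl
  have hu : D.level z = D.level y := D.strictMono_radius.injective hr
  -- the positions agree
  have hp : D.position (z 0) = D.position (y 0) := by
    have h1 := position_sub_lt_of_stage_le hz (stage_le_of_fold_eq hz hy h hw)
    have h2 := position_sub_lt_of_stage_le hy (stage_le_of_fold_eq hy hz h.symm hw.symm)
    rw [hu] at h1 hn
    have hL : 0 < D.radiusDeriv (D.level y) := two_pos.trans_le (D.two_le_radiusDeriv _)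
    have h3 : D.position (y 0) - D.position (z 0) = n * D.radiusDeriv (D.level y) := by
      field_simp at hn
      linarith
    have h4 : n = 0 := by
      have h5 : (n : ℝ) < 1 := by
        by_contra hcon
        push Not at hcon
        nlinarith
      have h6 : (-1 : ℝ) < n := by
        by_contra hcon
        push Not at hcon
        nlinarith
      have h5' : n < 1 := by exact_mod_cast h5
      have h6' : -1 < n := by exact_mod_cast h6
      omega
    rw [h4] at h3
    simp at h3
    linarith
  have hs : D.stage (z 0) = D.stage (y 0) := by unfold stage; rw [hp]
  -- the last coordinates agree, and then the fibre coordinates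
  rw [hs, hw] at e2
  have h2 : z 2 = y 2 := add_right_cancel e2
  rw [hs, hw, h2] at hl
  have hφ : (z 1).im = (y 1).im := by
    have h3 : (z 1).im - (y 1).im = l := by
      unfold angle at hl
      rw [hp] at hl
      linarith
    have hm := D.m_pos
    have h4 : l = 0 := by
      have h5 : (l : ℝ) < 1 := by linarith [hz.2.2.2.2.2.1, hy.2.2.2.2.1]
      have h6 : (-1 : ℝ) < l := by linarith [hy.2.2.2.2.2.1, hz.2.2.2.2.1]
      have h5' : l < 1 := by exact_mod_cast h5
      have h6' : -1 < l := by exact_mod_cast h6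
      omega
    rw [h4] at h3
    simp at h3
    linarith
  have hψ : D.angle z = D.angle y := by unfold angle; rw [hp, hφ]
  have hw1 : (z 1).re = (y 1).re := by
    unfold fibreArea at hw
    rw [hψ] at hw
    linarith
  -- the coordinates of the strip
  have hh : D.height (z 0) = D.height (y 0) := by
    unfold level at hu
    rw [hp, hw1] at hu
    linarith
  have hX : (z 0).re = (y 0).re := by
    rw [← D.profile_height, ← D.profile_height, hh]
  have hY : (z 0).im = (y 0).im := by
    unfold position at hp
    rw [hh] at hp
    have := D.η_pos.trans_le (D.η_le_profileDeriv (D.height (y 0)))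
    exact mul_right_cancel₀ this.ne' (by linarith)
  funext i
  fin_cases i
  · exact Complex.ext hX hY
  · exact Complex.ext hw1 hφ
  · exact h2

/-- The area coordinates of the image. -/
theorem norm_sq_fold {z : Fin 3 → ℂ} (hz : z ∈ D.domain) :
    Real.pi * ‖D.fold z 0‖ ^ 2 = D.radius (D.level z) ∧
      Real.pi * ‖D.fold z 1‖ ^ 2 = D.fibreArea z := by
  rw [fold, stageFold_zero, stageFold_one]
  constructor
  · rw [norm_sq_fromPolar, re_ofReal_add_ofReal_mul_I]
    rw [re_ofReal_add_ofReal_mul_I]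
    exact (radius_level_pos hz).le
  · rw [norm_sq_fromPolar, re_ofReal_add_ofReal_mul_I]
    rw [re_ofReal_add_ofReal_mul_I]
    exact (fibreArea_pos hz).le

/-- At the positions up to `2 a` the last coordinate has a bound in which the width of the ribbon
does not enter. -/
theorem norm_fold_two_le {z : Fin 3 → ℂ} (hz : z ∈ D.domain) (h : D.position (z 0) < 2 * D.a) :
    ‖D.fold z 2‖ ≤ D.R + 3 * D.R * (2 * D.a + 1) := by
  have hR := D.R_pos
  have ha := D.one_lt_a
  rw [fold, stageFold_two]
  have h1 := D.shift_mem (D.stage (z 0)) (D.fibreArea z)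
  have h2 : (-1 : ℝ) ≤ D.stage (z 0) := by exact_mod_cast neg_one_le_stage (D := D) (z 0)
  have h3 : (D.stage (z 0) : ℝ) ≤ 2 * D.a := by
    rcases lt_or_ge (D.stage (z 0)) 0 with h | h
    · have : (D.stage (z 0) : ℝ) < 0 := by exact_mod_cast h
      linarith
    · linarith [stage_le_position h]
  have h4 : |D.shift (D.stage (z 0)) (D.fibreArea z)| ≤ 3 * D.R * (2 * D.a + 1) := by
    rw [abs_le]
    constructor <;> nlinarith
  refine (norm_add_le _ _).trans (add_le_add hz.2.2.2.2.2.2.2.le ?_)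
  rwa [Complex.norm_real]

end FoldData

/-! ### The target -/

/-- The pairs `(u, w)` with `u + w ≤ 2 lam` lie in the target once `u` has been turned into the area
coordinate `t` of the base. -/
theorem le_foldBound {a lam μ t u w : ℝ} (ha : 1 < a) (hlam : lam = 1 - μ / a)
    (hl1 : lam * (a + 1) ≤ a) (hl2 : lam < 1)
    (hu : u ≤ lam) (huw : u + w ≤ 2 * lam)
    (ht : t ≤ max (2 * u) ((a + 1) * u - a * (2 * lam - 1))) :
    t ≤ lam + μ ∧ w ≤ foldBound lam μ t := by
  have ha0 : a ≠ 0 := by linarith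
  have hμ : μ = a * (1 - lam) := by rw [hlam]; field_simp; ring
  have ha1 : 0 < a - 1 := by linarith
  have hl3 : 0 < 1 - lam := by linarith
  have hτ : 2 * μ * ((2 * lam - 1) / (lam + μ - 1)) = 2 * (a * (2 * lam - 1)) / (a - 1) := by
    have e : lam + μ - 1 = (a - 1) * (1 - lam) := by rw [hμ]; ring
    rw [e, hμ]
    field_simp
  constructor
  · rcases le_max_iff.1 ht with h | h
    · nlinarith
    · nlinarith
  · unfold foldBound
    rw [hτ]
    split_ifs with h
    · rw [le_div_iff₀ ha1] at h
      have : t ≤ 2 * u := by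
        rcases le_max_iff.1 ht with h' | h'
        · exact h'
        · by_contra hcon
          push Not at hcon
          nlinarith
      linarith
    · rw [not_le, div_lt_iff₀ ha1] at h
      have h2 : t ≤ (a + 1) * u - a * (2 * lam - 1) := by
        rcases le_max_iff.1 ht with h' | h'
        · by_contra hcon
          push Not at hcon
          nlinarith
        · exact h'
      have e : (1 - lam) * (t - 2 * lam + 1) / (1 - lam + μ) = (t - 2 * lam + 1) / (1 + a) := by
        have e1 : 1 - lam + μ = (1 - lam) * (1 + a) := by rw [hμ]; ring
        have : (1 + a) ≠ 0 := by linarith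
        rw [e1]
        field_simp
      rw [e, le_sub_iff_add_le, ← le_sub_iff_add_le', div_le_iff₀ (by linarith)]
      nlinarith

theorem norm_le_of_pi_mul_sq_le {z : ℂ} {t : ℝ} (h : Real.pi * ‖z‖ ^ 2 ≤ t) : ‖z‖ ≤ 1 + t := by
  have := Real.pi_gt_three
  nlinarith [sq_nonneg (‖z‖ - 1), sq_nonneg ‖z‖]

/-- On bounded parts of the last factor, a neighborhood of the target contains all points which
satisfy its inequalities up to a small error. -/
theorem exists_error_bound {lam R : ℝ} {g : ℝ → ℝ} (hg : Continuous g)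
    {U X : Set (Fin 3 → ℂ)} (hU : U ∈ 𝓝ˢ X)
    (hX : ∀ (z : Fin 3 → ℂ) (u : ℝ), 0 ≤ u → u ≤ lam → u + Real.pi * ‖z 1‖ ^ 2 ≤ 2 * lam →
      Real.pi * ‖z 0‖ ^ 2 ≤ g u → z ∈ X) :
    ∃ e > 0, ∀ (z : Fin 3 → ℂ) (u : ℝ), 0 ≤ u → u ≤ lam + e →
      u + Real.pi * ‖z 1‖ ^ 2 ≤ 2 * (lam + e) → Real.pi * ‖z 0‖ ^ 2 ≤ g u → ‖z 2‖ ≤ R →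
      z ∈ U := by
  have cz : ∀ i, Continuous fun p : ℝ × (Fin 3 → ℂ) => Real.pi * ‖p.2 i‖ ^ 2 := fun i =>
    continuous_const.mul (((continuous_apply i).comp continuous_snd).norm.pow 2)
  obtain ⟨M, hM⟩ := (isCompact_Icc (a := (0 : ℝ)) (b := lam + 1)).bddAbove_image hg.continuousOn
  set C : Set (ℝ × (Fin 3 → ℂ)) := {p | (0 ≤ p.1 ∧ p.1 ≤ lam + 1) ∧
    Real.pi * ‖p.2 0‖ ^ 2 ≤ g p.1 ∧ p.1 + Real.pi * ‖p.2 1‖ ^ 2 ≤ 2 * (lam + 1) ∧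
    ‖p.2 2‖ ≤ R} with hC
  have hCc : IsCompact C := by
    refine ((isCompact_Icc (a := (0 : ℝ)) (b := lam + 1)).prod
      (isCompact_univ_pi fun i : Fin 3 => isCompact_closedBall (0 : ℂ)
        ((![1 + M, 1 + 2 * (lam + 1), R] : Fin 3 → ℝ) i))).of_isClosed_subset ?_ ?_
    · exact ((isClosed_le continuous_const continuous_fst).inter
        (isClosed_le continuous_fst continuous_const)).inter
        ((isClosed_le (cz 0) (hg.comp continuous_fst)).inter
        ((isClosed_le (continuous_fst.add (cz 1)) continuous_const).inter
        (isClosed_le ((continuous_apply 2).comp continuous_snd).norm continuous_const)))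
    · rintro ⟨u, z⟩ ⟨hu, h0, h1, h2⟩
      refine ⟨hu, fun i _ => ?_⟩
      rw [mem_closedBall_zero_iff]
      fin_cases i
      · exact norm_le_of_pi_mul_sq_le (h0.trans (hM ⟨u, hu, rfl⟩))
      · have h3 : Real.pi * ‖z 1‖ ^ 2 ≤ 2 * (lam + 1) := by
          have := hu.1
          simp only at h1 this
          linarith
        exact norm_le_of_pi_mul_sq_le h3
      · exact h2
  have hK : IsCompact (C \ Prod.snd ⁻¹' interior U) := by
    exact hCc.diff (isOpen_interior.preimage continuous_snd)
  have key : ∀ e, 0 < e → e ≤ 1 → (∀ p ∈ C \ Prod.snd ⁻¹' interior U,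
      e < max (p.1 - lam) ((p.1 + Real.pi * ‖p.2 1‖ ^ 2) / 2 - lam)) →
      ∀ (z : Fin 3 → ℂ) (u : ℝ), 0 ≤ u → u ≤ lam + e →
      u + Real.pi * ‖z 1‖ ^ 2 ≤ 2 * (lam + e) → Real.pi * ‖z 0‖ ^ 2 ≤ g u → ‖z 2‖ ≤ R →
      z ∈ U := by
    intro e he he1 h z u h0 h1 h2 h3 h4
    by_contra hcon
    have h5 := h (u, z) ⟨⟨⟨h0, by simp only; linarith⟩, h3, by simp only; linarith, h4⟩,
      fun h6 => hcon (interior_subset h6)⟩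
    rcases lt_max_iff.1 h5 with h6 | h6
    · simp only at h6; linarith
    · simp only at h6; linarith
  rcases (C \ Prod.snd ⁻¹' interior U).eq_empty_or_nonempty with hempty | hne
  · exact ⟨1, one_pos, key 1 one_pos le_rfl (by simp [hempty])⟩
  · obtain ⟨p, hp, hmin⟩ := hK.exists_isMinOn hne
      (((continuous_fst.sub continuous_const).max (((continuous_fst.add (cz 1)).div_const 2).sub
        continuous_const)).continuousOn (f := fun p : ℝ × (Fin 3 → ℂ) =>
          max (p.1 - lam) ((p.1 + Real.pi * ‖p.2 1‖ ^ 2) / 2 - lam)))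
    set m := max (p.1 - lam) ((p.1 + Real.pi * ‖p.2 1‖ ^ 2) / 2 - lam) with hm
    have hm0 : 0 < m := by
      by_contra hcon
      push Not at hcon
      obtain ⟨h1, h2⟩ := max_le_iff.1 hcon
      refine hp.2 (subset_interior_iff_mem_nhdsSet.2 hU
        (hX p.2 p.1 hp.1.1.1 (by linarith) (by linarith) hp.1.2.1))
    have hlt : min (m / 2) 1 < m := (min_le_left _ _).trans_lt (by linarith)
    exact ⟨min (m / 2) 1, lt_min (by linarith) one_pos,
      key _ (lt_min (by linarith) one_pos) (min_le_right _ _)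
        fun q hq => hlt.trans_le (hmin hq)⟩

/-! ### The embedding of the ellipsoid -/

/-- On the unit disc the angles in the half-strip stay away from `0` and `1`. -/
theorem exists_margin {k : ℝ} (hk : 0 < k) :
    ∃ m, 0 < m ∧ m < 1 / 2 ∧ ∀ z : ℂ, ‖z‖ ≤ 1 →
      m < (toStrip k z).im ∧ (toStrip k z).im < 1 - m := by
  have hc : ContinuousOn (fun z => (toStrip k z).im) (Metric.closedBall (0 : ℂ) 1) :=
    (Complex.continuous_im.comp (continuous_toStrip hk)).continuousOn
  have hne : (Metric.closedBall (0 : ℂ) 1).Nonempty := ⟨0, by simp⟩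
  obtain ⟨p, _, hp⟩ := (isCompact_closedBall (0 : ℂ) 1).exists_isMinOn hne hc
  obtain ⟨q, _, hq⟩ := (isCompact_closedBall (0 : ℂ) 1).exists_isMaxOn hne hc
  have h1 := toStrip_im_mem (k := k) p
  have h2 := toStrip_im_mem (k := k) q
  have hpos : 0 < min (toStrip k p).im (1 - (toStrip k q).im) :=
    lt_min h1.1 (by linarith [h2.2])
  have hle1 := min_le_left (toStrip k p).im (1 - (toStrip k q).im)
  have hle2 := min_le_right (toStrip k p).im (1 - (toStrip k q).im)
  refine ⟨min (toStrip k p).im (1 - (toStrip k q).im) / 2, by linarith, by linarith [h1.2],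
    fun z hz => ?_⟩
  have h3 : (toStrip k p).im ≤ (toStrip k z).im := hp (by simpa using hz)
  have h4 : (toStrip k z).im ≤ (toStrip k q).im := hq (by simpa using hz)
  constructor <;> linarith

theorem proposition3p1 (a S μ lam : ℝ) (ha : 1 < a) (hS : 0 < S)
    (hμ₁ : a / (a + 1) ≤ μ) (hμ₂ : μ ≤ a / 2) (hlam : lam = 1 - μ / a)
    (U : Set (Fin 3 → ℂ)) (hU : U ∈ 𝓝ˢ (stabilize (foldDomain lam μ))) :
    SymplecticallyEmbeds (ellipsoid ![a, 1, S]) U := by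
  have hpi := Real.pi_pos
  have hpi3 := Real.pi_gt_three
  have ha0 : 0 < a := by linarith
  have hl0 : 1 / 2 ≤ lam := by
    have : μ / a ≤ 1 / 2 := by rw [div_le_iff₀ ha0]; linarith
    linarith
  have hμ0 : 0 < μ := lt_of_lt_of_le (by positivity) hμ₁
  have hl1 : lam * (a + 1) ≤ a := by
    rw [div_le_iff₀ (by linarith)] at hμ₁
    have e : lam * (a + 1) = a + 1 - μ * (a + 1) / a := by rw [hlam]; field_simp
    have : 1 ≤ μ * (a + 1) / a := by rw [le_div_iff₀ ha0]; linarith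
    linarith
  have hl2 : lam < 1 := by
    have : 0 < μ / a := by positivity
    linarith
  set g : ℝ → ℝ := fun u => max (2 * u) ((a + 1) * u - a * (2 * lam - 1)) with hg
  have hX : ∀ (z : Fin 3 → ℂ) (u : ℝ), 0 ≤ u → u ≤ lam → u + Real.pi * ‖z 1‖ ^ 2 ≤ 2 * lam →
      Real.pi * ‖z 0‖ ^ 2 ≤ g u → z ∈ stabilize (foldDomain lam μ) :=
    fun z u _ h1 h2 h3 => le_foldBound ha hlam hl1 hl2 h1 h2 h3
  -- the bound `R` for the last factor does not depend on the error `e`, which is chosen after it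
  set R := √(2 * S / Real.pi) with hR
  have hR0 : 0 < R := Real.sqrt_pos.2 (by positivity)
  have hR2 : R ^ 2 = 2 * S / Real.pi := Real.sq_sqrt (by positivity)
  obtain ⟨e, he, hUe⟩ := exists_error_bound (R := R + 3 * R * (2 * a + 1))
    (show Continuous g by fun_prop) hU hX
  set η := min (e / 3) 1 with hη
  have hη0 : 0 < η := lt_min (by linarith) one_pos
  have hηe : 3 * η ≤ e := by linarith [min_le_left (e / 3) 1]
  -- with this `k` the straightening increases the areas by at most `η / 16`
  set k := η / (32 * Real.pi) with hk
  have hk0 : 0 < k := by positivity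
  have hkη : 2 * Real.pi * k = η / 16 := by rw [hk]; field_simp; norm_num
  obtain ⟨m, hm0, hm1, hm⟩ := exists_margin hk0
  let D : FoldData :=
    { a := a, lam := lam, η := η, m := min m η, R := R, one_lt_a := ha, half_le_lam := hl0
      lam_mul_le := hl1, η_pos := hη0, η_le := min_le_right _ _, m_pos := lt_min hm0 hη0
      m_lt := (min_le_left _ _).trans_lt hm1, m_le := min_le_right _ _, R_pos := hR0 }
  let T : Fin 3 → ℂ → ℂ := ![toStrip k, toStrip k, fun x => x]
  let V : Set (Fin 3 → ℂ) :=
    {z | ∑ i, Real.pi * ‖z i‖ ^ 2 / (![a, 1, S] : Fin 3 → ℝ) i < 1 + η / 8}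
  have hVo : IsOpen V := by
    refine isOpen_lt ?_ continuous_const
    exact continuous_finsetSum _ fun i _ =>
      (continuous_const.mul ((continuous_apply i).norm.pow 2)).div_const _
  have hVD : ∀ z ∈ V, (fun i => T i (z i)) ∈ D.domain := by
    intro z hz
    have hz' : Real.pi * ‖z 0‖ ^ 2 / a + Real.pi * ‖z 1‖ ^ 2 + Real.pi * ‖z 2‖ ^ 2 / S
        < 1 + η / 8 := by
      have : ∑ i, Real.pi * ‖z i‖ ^ 2 / (![a, 1, S] : Fin 3 → ℝ) i < 1 + η / 8 := hz
      simpa [Fin.sum_univ_three] using this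
    have p0 : 0 ≤ Real.pi * ‖z 0‖ ^ 2 / a := by positivity
    have p1 : 0 ≤ Real.pi * ‖z 1‖ ^ 2 := by positivity
    have p2 : 0 ≤ Real.pi * ‖z 2‖ ^ 2 / S := by positivity
    have hη1 : η ≤ 1 := min_le_right _ _
    have hz1 : ‖z 1‖ ≤ 1 := by
      by_contra hcon
      push Not at hcon
      nlinarith
    have hz2 : ‖z 2‖ < R := by
      refine lt_of_pow_lt_pow_left₀ 2 hR0.le ?_
      have : Real.pi * ‖z 2‖ ^ 2 / S < 2 := by linarith
      rw [div_lt_iff₀ hS] at this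
      rw [hR2, lt_div_iff₀ hpi]
      linarith
    have t0 := toStrip_re_lt hk0 (z 0)
    have t1 := toStrip_re_lt hk0 (z 1)
    have t0' : (toStrip k (z 0)).re / a < Real.pi * ‖z 0‖ ^ 2 / a + η / 16 := by
      rw [div_lt_iff₀ ha0, add_mul, div_mul_cancel₀ _ ha0.ne']
      nlinarith
    refine ⟨toStrip_re_pos hk0 _, (toStrip_im_mem _).1, (toStrip_im_mem _).2,
      toStrip_re_pos hk0 _, (min_le_left m η).trans_lt (hm _ hz1).1,
      (hm _ hz1).2.trans_le (sub_le_sub_left (min_le_left m η) 1), ?_, hz2⟩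
    show (toStrip k (z 0)).re / a + (toStrip k (z 1)).re < 1 + η / 4
    linarith
  have hT : ∀ z, IsSymplecticAt (fun z i => T i (z i)) z := by
    intro z
    refine isSymplecticAt_pi fun i => ?_
    fin_cases i
    · exact isAreaPreservingAt_toStrip hk0 _
    · exact isAreaPreservingAt_toStrip hk0 _
    · exact isAreaPreservingAt_id _
  have hΦ : ∀ z ∈ V, IsSymplecticAt (fun z => D.fold fun i => T i (z i)) z := fun z hz =>
    (FoldData.isSymplecticAt_fold (hVD z hz)).comp (hT z)
  have hEV : ellipsoid ![a, 1, S] ⊆ V := by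
    intro z hz
    have : ∑ i, Real.pi * ‖z i‖ ^ 2 / (![a, 1, S] : Fin 3 → ℝ) i ≤ 1 := hz
    exact this.trans_lt (by linarith)
  refine ⟨fun z => D.fold fun i => T i (z i), ⟨V, hVo, hEV,
    fun z hz => (hΦ z hz).1.contDiffWithinAt, ?_, fun z hz => (hΦ z hz).2⟩, ?_⟩
  · intro z hz y hy h
    have h1 := FoldData.injOn_fold (hVD z hz) (hVD y hy) h
    funext i
    have h2 := congrFun h1 i
    fin_cases i
    · exact toStrip_injective hk0 h2
    · exact toStrip_injective hk0 h2
    · exact h2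
  · intro z hz
    have hD := hVD z (hEV hz)
    set y : Fin 3 → ℂ := fun i => T i (z i) with hy
    obtain ⟨h0, h1⟩ := FoldData.norm_sq_fold hD
    have hpos := FoldData.level_pos hD
    have hr : Real.pi * ‖D.fold y 0‖ ^ 2 ≤ g (D.level y) := by
      rw [h0]; exact D.radius_le _
    show D.fold y ∈ U
    rcases lt_or_ge (D.position (y 0)) (2 * a) with h | h
    · obtain ⟨b1, b2⟩ := FoldData.level_bounds hD
      have b1' : D.level y ≤ lam + 3 * η := b1
      have b2' : D.level y + D.fibreArea y ≤ 2 * (lam + 3 * η) := b2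
      exact hUe _ _ hpos.le (by linarith) (by rw [h1]; linarith) hr
        (FoldData.norm_fold_two_le hD h)
    · obtain ⟨b1, b2⟩ := FoldData.level_bounds_of_le hD h
      refine subset_of_mem_nhdsSet hU (hX _ _ hpos.le b1 ?_ hr)
      rw [h1]
      exact b2
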